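/- Let $\mathcal L=\{(\vec v,\mathbf x)\in S^2\times\mathbb R^3:\ \mathbf x\cdot\vec v=0\}$ be the space of oriented lines in $\mathbb R^3$ ($\vec v$ is the unit direction vector of the line and $\mathbf x$ its point nearest to the origin), with the Euclidean metric of $\mathbb R^3\times\mathbb R^3$. Let $\ell_1$ be the positively oriented $x$-axis, with direction $\vec e_1$. The reduced configuration space of two oriented lines is the set $\mathcal N\subseteq\mathcal L$ of oriented lines $\ell_2$ disjoint from $\ell_1$. For $a,b\in\mathcal N$ let $\delta'(a,b)\in[0,\infty]$ be the infimum of the lengths of the paths from $a$ to $b$ in $\mathcal N$, and let $d_{\mathrm{path}}=\min\{\delta',1\}$. The reduced completed configuration space $\widehat{\mathcal C}$ is the completion of $(\mathcal N,d_{\mathrm{path}})$, and $\hat\varphi:\widehat{\mathcal C}\to\mathcal L$ is the continuous extension of the inclusion $\mathcal N\hookrightarrow\mathcal L$. Let $\iota:S^2\to\mathcal L$, $\iota(\vec v)=(\vec v,\mathbf 0)$, be the map that sends a direction to the oriented line through the origin in that direction. Let $T$ be the twice-pinched torus: two copies of $S^2$ glued to each other at their north poles $\vec e_1$ and at their south poles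 $-\vec e_1$, with pinch points $n,s\in T$ the common north pole and the common south pole. Let $\nabla:T\to S^2$ be the map that is the identity on each of the two spheres. In $S^2\vee S^2\vee S^1$ take the north poles as base points of the spheres, and let $\nabla':S^2\vee S^2\vee S^1\to S^2$ be the identity on each of the two spheres and collapse the circle to the base point. Then $\iota$ is a homotopy equivalence, and there are homotopy equivalences $$e:\widehat{\mathcal C}\to T,\qquad g:T\to S^2\vee S^2\vee S^1$$ (so that $\widehat{\mathcal C}\simeq S^2\vee S^2\vee S^1$), with a homotopy inverse $e'$ of $e$, such that 1. $\hat\varphi\simeq\iota\circ\nabla\circ e$ and $\nabla\simeq\nabla'\circ g$; that is, up to homotopy $\hat\varphi$ sends each of the two spheres to $S^2$ by the identity; 2. the pinch points correspond to the two oriented parallels to $\ell_1$: for $c\in\widehat{\mathcal C}$, $e(c)=n$ if and only if $\hat\varphi(c)$ has direction $\vec e_1$, and $e(c)=s$ if and only if $\hat\varphi(c)$ has direction $-\vec e_1$; 3. the pinch points are sent to the two poles: $\hat\varphi(e'(n))=\iota(\vec e_1)$ and $\hat\varphi(e'(s))=\iota(-\vec e_1)$. -/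

import Mathlib

open scoped ENNReal ContinuousMap

noncomputable section

/-! ## The path metric on a subset of a metric space -/

/-- The infimum `δ'(a, b)` of the lengths, measured in `X`, of the paths from `a` to `b` inside `S`
(it is `∞` if there is no rectifiable path). -/
def pathEDist {X : Type*} [MetricSpace X] (S : Set X) (a b : S) : ℝ≥0∞ :=
  ⨅ γ : Path a b, eVariationOn (fun t : unitInterval => (γ t : X)) Set.univ

theorem pathEDist_self {X : Type*} [MetricSpace X] (S : Set X) (a : S) : pathEDist S a a = 0 := by
  refine le_antisymm ((iInf_le _ (Path.refl a)).trans ?_) zero_le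
  refine (eVariationOn.eq_zero_iff _ |>.2 fun s _ t _ => ?_).le
  exact edist_self _

theorem edist_le_pathEDist {X : Type*} [MetricSpace X] (S : Set X) (a b : S) :
    edist (a : X) (b : X) ≤ pathEDist S a b := by
  refine le_iInf fun γ => ?_
  have h := eVariationOn.edist_le (fun t : unitInterval => (γ t : X))
    (Set.mem_univ (0 : unitInterval)) (Set.mem_univ (1 : unitInterval))
  simpa using h

theorem pathEDist_comm_le {X : Type*} [MetricSpace X] (S : Set X) (a b : S) :
    pathEDist S a b ≤ pathEDist S b a := by
  refine le_iInf fun γ => (iInf_le _ γ.symm).trans ?_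
  exact eVariationOn.comp_le_of_antitoneOn (fun t : unitInterval => (γ t : X)) unitInterval.symm
    (fun x _ y _ h => unitInterval.symm_le_symm.2 h) (fun _ _ => Set.mem_univ _)

theorem pathEDist_triangle {X : Type*} [MetricSpace X] (S : Set X) (a b c : S) :
    pathEDist S a c ≤ pathEDist S a b + pathEDist S b c := by
  unfold pathEDist
  refine ENNReal.le_iInf_add_iInf fun γ γ' => (iInf_le _ (γ.trans γ')).trans ?_
  let h : unitInterval := ⟨1 / 2, by norm_num, by norm_num⟩
  let φ : unitInterval → unitInterval := fun t => Set.projIcc 0 1 zero_le_one (2 * (t : ℝ))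
  let ψ : unitInterval → unitInterval := fun t => Set.projIcc 0 1 zero_le_one (2 * (t : ℝ) - 1)
  have hu : (Set.univ : Set unitInterval) = Set.Iic h ∪ Set.Ici h := Set.Iic_union_Ici.symm
  have hφ : Set.EqOn (fun t => ((γ.trans γ') t : X)) ((fun t => (γ t : X)) ∘ φ) (Set.Iic h) := by
    intro t ht
    have ht' : (t : ℝ) ≤ 1 / 2 := ht
    have := t.2.1
    simp only [Path.trans_apply, dif_pos ht', Function.comp_apply]
    congr 2
    exact (Set.projIcc_of_mem zero_le_one _).symm
  have hψ : Set.EqOn (fun t => ((γ.trans γ') t : X)) ((fun t => (γ' t : X)) ∘ ψ) (Set.Ici h) := by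
    intro t ht
    have ht' : 1 / 2 ≤ (t : ℝ) := ht
    rcases ht'.eq_or_lt with h0 | h0
    · have h1 : ψ t = 0 := by
        apply Set.projIcc_of_le_left
        linarith
      simp only [Path.trans_apply, dif_pos h0.symm.le, Function.comp_apply, h1]
      rw [γ'.source]
      have : (⟨2 * (t : ℝ), (unitInterval.mul_pos_mem_iff zero_lt_two).2 ⟨t.2.1, h0.symm.le⟩⟩ :
          unitInterval) = 1 := Subtype.ext (by simp [← h0])
      rw [this, γ.target]
    · have h2 := t.2.2
      simp only [Path.trans_apply, dif_neg (not_le.2 h0), Function.comp_apply]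
      congr 2
      exact (Set.projIcc_of_mem zero_le_one _).symm
  rw [show eVariationOn (fun t => ((γ.trans γ') t : X)) Set.univ =
    eVariationOn (fun t => ((γ.trans γ') t : X)) (Set.Iic h ∪ Set.Ici h) by rw [← hu],
    eVariationOn.union (x := h) _ isGreatest_Iic isLeast_Ici,
    eVariationOn.congr hφ, eVariationOn.congr hψ]
  refine add_le_add ?_ ?_
  · refine eVariationOn.comp_le_of_monotoneOn _ φ ?_ (fun _ _ => Set.mem_univ _)
    intro s _ t _ hst
    refine Set.monotone_projIcc _ ?_
    have : (s : ℝ) ≤ t := hst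
    linarith
  · refine eVariationOn.comp_le_of_monotoneOn _ ψ ?_ (fun _ _ => Set.mem_univ _)
    intro s _ t _ hst
    refine Set.monotone_projIcc _ ?_
    have : (s : ℝ) ≤ t := hst
    linarith

/-- The set `S`, to be equipped with its path metric. -/
structure PathSpace {X : Type*} (S : Set X) where
  pt : S

/-- The path metric `d_path = min(δ', 1)`. -/
instance {X : Type*} [MetricSpace X] (S : Set X) : MetricSpace (PathSpace S) where
  dist a b := (min (pathEDist S a.pt b.pt) 1).toReal
  dist_self a := by simp [pathEDist_self]
  dist_comm a b := by
    rw [le_antisymm (pathEDist_comm_le S a.pt b.pt) (pathEDist_comm_le S b.pt a.pt)]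
  dist_triangle a b c := by
    have hfin : ∀ x : ℝ≥0∞, min x 1 ≠ ∞ := fun x =>
      ((min_le_right x 1).trans_lt ENNReal.one_lt_top).ne
    rw [← ENNReal.toReal_add (hfin _) (hfin _)]
    refine ENNReal.toReal_mono (ENNReal.add_ne_top.2 ⟨hfin _, hfin _⟩) ?_
    have h := pathEDist_triangle S a.pt b.pt c.pt
    rcases le_total (pathEDist S a.pt b.pt) 1 with h1 | h1
    · rcases le_total (pathEDist S b.pt c.pt) 1 with h2 | h2
      · rw [min_eq_left h1, min_eq_left h2]
        exact (min_le_left _ _).trans h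
      · rw [min_eq_right h2]
        exact (min_le_right _ _).trans le_add_self
    · rw [min_eq_right h1]
      exact (min_le_right _ _).trans le_self_add
  eq_of_dist_eq_zero := by
    rintro ⟨a⟩ ⟨b⟩ h
    have h' : min (pathEDist S a b) 1 = 0 := by
      rcases (ENNReal.toReal_eq_zero_iff _).1 h with h | h
      · exact h
      · exact absurd h ((min_le_right _ _).trans_lt ENNReal.one_lt_top).ne
    have h0 : pathEDist S a b = 0 := by
      rcases min_eq_iff.1 h' with h | h
      · exact h.1
      · exact absurd h.1 one_ne_zero
    have h1 := (edist_le_pathEDist S a b).trans h0.le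
    rw [Subtype.ext (edist_le_zero.1 h1)]

theorem PathSpace.uniformContinuous_pt {X : Type*} [MetricSpace X] (S : Set X) :
    UniformContinuous fun a : PathSpace S => (a.pt : X) := by
  refine Metric.uniformContinuous_iff.2 fun ε hε => ⟨min ε 1, by positivity, fun {a b} hab => ?_⟩
  have hab' : (min (pathEDist S a.pt b.pt) 1).toReal < min ε 1 := hab
  have h1 : pathEDist S a.pt b.pt < 1 := by
    by_contra! hc
    rw [min_eq_right hc] at hab'
    simp at hab'
  rw [min_eq_left h1.le] at hab'
  have h2 := ENNReal.toReal_mono (h1.trans ENNReal.one_lt_top).ne (edist_le_pathEDist S a.pt b.pt)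
  rw [edist_dist, ENNReal.toReal_ofReal dist_nonneg] at h2
  exact h2.trans_lt (hab'.trans_le (min_le_left _ _))

/-! ## Oriented lines in space -/

/-- Euclidean 3-space. -/
abbrev E3 : Type := EuclideanSpace ℝ (Fin 3)

/-- The unit sphere in `ℝ³`. -/
abbrev S2 : Type := Metric.sphere (0 : E3) 1

/-- The space `ℒ` of oriented lines in `ℝ³`: the pairs `(v, x)` in `ℝ³ × ℝ³` of the unit direction
vector `v` of the line and of its point `x` nearest to the origin, with the Euclidean metric. -/
def orientedLines : Set (WithLp 2 (E3 × E3)) :=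
  {p | ‖p.fst‖ = 1 ∧ inner ℝ p.snd p.fst = 0}

abbrev OrientedLine : Type := orientedLines

theorem isClosed_orientedLines : IsClosed orientedLines := by
  have h1 : Continuous fun p : WithLp 2 (E3 × E3) => p.fst := by fun_prop
  have h2 : Continuous fun p : WithLp 2 (E3 × E3) => p.snd := by fun_prop
  exact (isClosed_eq h1.norm continuous_const).inter (isClosed_eq (h2.inner h1) continuous_const)

instance : CompleteSpace OrientedLine := isClosed_orientedLines.completeSpace_coe

namespace OrientedLine

/-- The unit direction vector of an oriented line. -/
def direction (l : OrientedLine) : S2 := ⟨l.1.fst, by simpa using l.2.1⟩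

/-- The point of the line nearest to the origin. -/
def foot (l : OrientedLine) : E3 := l.1.snd

/-- The set of points of the line. -/
def points (l : OrientedLine) : Set E3 :=
  Set.range fun s : ℝ => l.foot + s • (l.direction : E3)

/-- The oriented line through the origin in a given direction, as a continuous function. -/
def throughOrigin : C(S2, OrientedLine) where
  toFun v := ⟨WithLp.toLp 2 ((v : E3), 0), by simp [orientedLines]⟩
  continuous_toFun := by fun_prop

end OrientedLine

/-- The unit vector `e₁`, the "north pole". -/
def northPole : S2 := ⟨EuclideanSpace.single 0 1, by simp⟩

/-- The unit vector `-e₁`, the "south pole". -/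
def southPole : S2 := -northPole

/-- The positively oriented `x`-axis. -/
def xAxis : OrientedLine := OrientedLine.throughOrigin northPole

/-! ## Configurations of two oriented lines -/

/-- The space of embeddings of two oriented lines: pairs of disjoint oriented lines. -/
def twoLineEmb : Set (OrientedLine × OrientedLine) :=
  {p | Disjoint p.1.points p.2.points}

/-- The reduced space of embeddings: the first line is the `x`-axis, so that a configuration is
given by the second line. -/
def reducedTwoLineEmb : Set OrientedLine := {l | (xAxis, l) ∈ twoLineEmb}

/-- The reduced completed configuration space: the completion of the reduced space of embeddings
with respect to its path metric. -/
abbrev CompletedTwoLines : Type := UniformSpace.Completion (PathSpace reducedTwoLineEmb)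

/-- The natural map to the space of oriented lines: the continuous extension to the completion of
the map that sends a configuration to its second line. -/
def secondLine : C(CompletedTwoLines, OrientedLine) where
  toFun := UniformSpace.Completion.extension
    fun a : PathSpace reducedTwoLineEmb => (a.pt : OrientedLine)
  continuous_toFun := UniformSpace.Completion.continuous_extension

theorem secondLine_coe (a : PathSpace reducedTwoLineEmb) :
    secondLine (a : CompletedTwoLines) = a.pt :=
  UniformSpace.Completion.extension_coe (PathSpace.uniformContinuous_pt reducedTwoLineEmb) a

/-! ## The two models -/

/-- Identify the two north poles with each other, and the two south poles with each other. -/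
def PinchRel (p q : S2 ⊕ S2) : Prop :=
  (p = .inl northPole ∧ q = .inr northPole) ∨ (p = .inl southPole ∧ q = .inr southPole)

/-- The twice-pinched torus: two copies of `S²` glued at the two north poles and at the two south
poles, with the quotient topology. -/
abbrev PinchedTorus : Type := Quot PinchRel

namespace PinchedTorus

/-- The common north pole of the two spheres. -/
def north : PinchedTorus := Quot.mk _ (.inl northPole)

/-- The common south pole of the two spheres. -/
def south : PinchedTorus := Quot.mk _ (.inl southPole)

/-- The map to `S²` that is the identity on each of the two spheres. -/
def fold : C(PinchedTorus, S2) where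
  toFun := Quot.lift (Sum.elim id id) (by rintro _ _ (⟨rfl, rfl⟩ | ⟨rfl, rfl⟩) <;> rfl)
  continuous_toFun := continuous_quot_lift _ (by fun_prop)

end PinchedTorus

/-- Identify the base points: the two north poles and `1` on the circle. -/
def WedgeRel (p q : S2 ⊕ S2 ⊕ Circle) : Prop :=
  p = .inl northPole ∧ (q = .inr (.inl northPole) ∨ q = .inr (.inr 1))

/-- The wedge sum `S² ∨ S² ∨ S¹`. -/
abbrev WedgeS2S2S1 : Type := Quot WedgeRel

/-- The map from `S² ∨ S² ∨ S¹` to `S²` that is the identity on each of the two spheres and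
collapses the circle to the base point. -/
def WedgeS2S2S1.fold : C(WedgeS2S2S1, S2) where
  toFun := Quot.lift (Sum.elim id (Sum.elim id fun _ => northPole))
    (by rintro _ _ ⟨rfl, rfl | rfl⟩ <;> rfl)
  continuous_toFun := continuous_quot_lift _ (by fun_prop)

end

/-!
A configuration of the completion is, up to its foot, a direction together with the side on which
the second line passes by the `x`-axis; the two sides meet exactly over the two directions
parallel to the axis. Moving the second line towards the origin therefore retracts the completion
onto two spheres of directions that share their poles.

*From the completion to the pinched torus.* The side is the sign of the determinant `chirality` of
`e₁`, the direction and the foot. It can only change along a path of disjoint lines where the path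
passes through a parallel to the axis. Hence, when the pinched torus is embedded in `S² × ℝ` as
the union of the graphs of `± width`, where `width` vanishes at the poles, the map `(v, x) ↦ (v, ±
width v)` is uniformly continuous for the path metric (`Cfg.uniformContinuous_embed_side`), and
extends to `CompletedTwoLines.side`.

*Scaling.* For `0 < r ≤ 1` the scaling `(v, x) ↦ (v, r x)` preserves disjointness from the axis
and does not increase the length of paths, so that it extends to the completion. There it is
Lipschitz in `r` with a constant that depends continuously on the point, and extends to `r = 0`:
this is the homotopy `CompletedTwoLines.shrink`. After scaling by `0` a path counts only with the
length of its directions (`CompletedTwoLines.dist_shrink_zero_le`). Consequently `shrink 0`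
depends only on the direction and the side (`Cfg.shrink_zero_eq`): lines of one direction passing
by on one side have feet in a half-plane, and at a pole the feet form a punctured plane, which is
connected. The same estimate shows that `shrink 0` is continuous in the direction
(`Cfg.continuous_limit`). This gives a section `CompletedTwoLines.ofSide` of `side` with `ofSide ∘
side = shrink 0`, homotopic to the identity.

*From the pinched torus to the wedge.* A map out of the sphere can be given a `tail`: the northern
hemisphere is stretched over the whole sphere and the southern one runs along a path. The map to
the wedge is the identity on the first sphere; on the second it has a tail that climbs the
meridian, runs around the circle and descends the meridian of the first sphere. The inverse sends
the circle to the loop through both pinch points. Along a meridian a tail is exactly the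
concatenation of paths (`tail_meridian`), so that both homotopies reduce to cancellations of paths
with their inverses, and they are fixed at the base points, where the pieces are glued.
-/

open scoped unitInterval

noncomputable section

open ContinuousMap

/-! ### Homotopies of maps out of the sphere -/

/-- Two maps to the sphere that are nowhere antipodal are homotopic along normalized segments; this
homotopy rests where the maps agree. -/
theorem homotopicRel_of_ne_neg {X : Type*} [TopologicalSpace X] (f g : C(X, S2))
    (h : ∀ x, f x ≠ -g x) : f.HomotopicRel g {x | f x = g x} := by
  have hne : ∀ (t : I) (x : X), (1 - (t : ℝ)) • (f x : E3) + (t : ℝ) • (g x : E3) ≠ 0 := by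
    intro t x h0
    have hf : ‖(f x : E3)‖ = 1 := by simp
    have hg : ‖(g x : E3)‖ = 1 := by simp
    have h1 : (1 - (t : ℝ)) • (f x : E3) = -((t : ℝ) • (g x : E3)) := eq_neg_of_add_eq_zero_left h0
    have h2 := congrArg norm h1
    rw [norm_neg, norm_smul, norm_smul, hf, hg, Real.norm_of_nonneg (sub_nonneg.2 t.2.2),
      Real.norm_of_nonneg t.2.1] at h2
    have h3 : (t : ℝ) = 1 / 2 := by linarith
    rw [h3] at h1
    apply h x
    ext1
    have h4 := congrArg (fun y : E3 => (2 : ℝ) • y) h1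
    simp only [smul_neg, smul_smul] at h4
    norm_num at h4
    simpa using h4
  have hc : Continuous fun p : I × X =>
      (1 - (p.1 : ℝ)) • (f p.2 : E3) + (p.1 : ℝ) • (g p.2 : E3) := by
    have hf : Continuous fun x => (f x : E3) := continuous_subtype_val.comp f.continuous
    have hg : Continuous fun x => (g x : E3) := continuous_subtype_val.comp g.continuous
    fun_prop
  refine ⟨⟨⟨⟨fun p => ⟨‖(1 - (p.1 : ℝ)) • (f p.2 : E3) + (p.1 : ℝ) • (g p.2 : E3)‖⁻¹ •
    ((1 - (p.1 : ℝ)) • (f p.2 : E3) + (p.1 : ℝ) • (g p.2 : E3)), ?_⟩, ?_⟩, ?_, ?_⟩, ?_⟩⟩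
  · simpa using norm_smul_inv_norm (𝕜 := ℝ) (hne p.1 p.2)
  · exact Continuous.subtype_mk ((hc.norm.inv₀ fun p => norm_ne_zero_iff.2 (hne p.1 p.2)).smul hc) _
  · intro x
    ext1
    simp
  · intro x
    ext1
    simp
  · intro t x hx
    ext1
    have hx' : f x = g x := hx
    simp [hx', ← add_smul]

/-- The longitudinal coordinate `⟨v, e₁⟩` of a point of the sphere. -/
def height (v : S2) : ℝ := (v : E3) 0

theorem continuous_height : Continuous height := by
  unfold height
  fun_prop

theorem height_north : height northPole = 1 := by simp [height, northPole]

theorem height_south : height southPole = -1 := by simp [height, southPole, northPole]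

theorem norm_sq_eq (v : E3) : ‖v‖ ^ 2 = v 0 ^ 2 + v 1 ^ 2 + v 2 ^ 2 := by
  simp [EuclideanSpace.norm_sq_eq, Fin.sum_univ_three]

theorem S2_sq (v : S2) : (v : E3) 0 ^ 2 + (v : E3) 1 ^ 2 + (v : E3) 2 ^ 2 = 1 := by
  rw [← norm_sq_eq]
  simp

/-- The map that doubles the polar angle on the northern hemisphere, and is constant on the
southern one. Doubling the angle between `v` and `e₁` gives `2 ⟨v, e₁⟩ v - e₁`, and replacing
`⟨v, e₁⟩` by `max ⟨v, e₁⟩ 0` extends this by `-e₁` to the southern hemisphere. -/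
def stretch : C(S2, S2) where
  toFun v := ⟨(2 * max (height v) 0) • (v : E3) - (northPole : E3), by
    rw [mem_sphere_zero_iff_norm, ← sq_eq_sq₀ (norm_nonneg _) zero_le_one, norm_sq_eq]
    have h := S2_sq v
    have h2 : max (height v) 0 * (max (height v) 0 - height v) = 0 := by
      rcases max_cases (height v) 0 with h | h <;> simp [h.1]
    simp only [northPole, height, PiLp.sub_apply, PiLp.smul_apply, smul_eq_mul,
      PiLp.single_apply] at *
    simp
    linear_combination 4 * (max ((v : E3) 0) 0) ^ 2 * h + 4 * h2⟩
  continuous_toFun := by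
    have := continuous_height
    fun_prop

theorem stretch_of_nonpos {v : S2} (h : height v ≤ 0) : stretch v = southPole := by
  ext1
  simp [stretch, h, southPole]

theorem stretch_of_nonneg {v : S2} (h : 0 ≤ height v) :
    (stretch v : E3) = (2 * height v) • (v : E3) - (northPole : E3) := by
  simp [stretch, h]

theorem stretch_north : stretch northPole = northPole := by
  ext1
  rw [stretch_of_nonneg (by simp [height_north]), height_north, two_mul, add_smul]
  simp

theorem stretch_south : stretch southPole = southPole :=
  stretch_of_nonpos (by simp [height_south])

theorem eq_north_of_height {v : S2} (h : height v = 1) : v = northPole := by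
  have h2 := S2_sq v
  unfold height at h
  have h1 : (v : E3) 1 = 0 := by nlinarith [sq_nonneg ((v : E3) 1), sq_nonneg ((v : E3) 2)]
  have h3 : (v : E3) 2 = 0 := by nlinarith [sq_nonneg ((v : E3) 1), sq_nonneg ((v : E3) 2)]
  ext i
  fin_cases i <;> simp [northPole, h, h1, h3]

theorem eq_south_of_height {v : S2} (h : height v = -1) : v = southPole := by
  have : -v = northPole := eq_north_of_height (by simp [height] at *; linarith)
  rw [southPole, ← this, neg_neg]

theorem stretch_homotopicRel_id :
    stretch.HomotopicRel (ContinuousMap.id S2) {northPole, southPole} := by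
  obtain ⟨H⟩ := homotopicRel_of_ne_neg stretch (ContinuousMap.id S2) (by
    intro v hv
    have h0 := congrArg (fun u : S2 => height u) hv
    rcases le_total (height v) 0 with h | h
    · rw [stretch_of_nonpos h] at hv
      have : v = northPole := by
        rw [← neg_neg v]
        simp only [id_apply] at hv
        simp [← hv, southPole]
      rw [this, height_north] at h
      linarith
    · have h1 := congrArg (fun u : S2 => (u : E3)) hv
      simp only [stretch_of_nonneg h] at h1
      have e0 := congrArg (fun u : E3 => u 0) h1
      have e1 := congrArg (fun u : E3 => u 1) h1
      have e2 := congrArg (fun u : E3 => u 2) h1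
      have h2 := S2_sq v
      simp [northPole, height] at e0 e1 e2 h
      have e1' : (2 * (v : E3) 0 + 1) * (v : E3) 1 = 0 := by linear_combination e1
      have e2' : (2 * (v : E3) 0 + 1) * (v : E3) 2 = 0 := by linear_combination e2
      have hp : 2 * (v : E3) 0 + 1 ≠ 0 := by positivity
      have e1'' := (mul_eq_zero.1 e1').resolve_left hp
      have e2'' := (mul_eq_zero.1 e2').resolve_left hp
      rw [e1'', e2''] at h2
      nlinarith)
  refine ⟨⟨H.toHomotopy, fun t x hx => H.prop' t x ?_⟩⟩
  rcases hx with rfl | rfl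
  · exact stretch_north
  · exact stretch_south

/-- The angular coordinate on the southern hemisphere, running from `0` on the equator to `1` at the
south pole (and equal to `0` on the northern hemisphere). -/
def southAngle (v : S2) : I :=
  Set.projIcc 0 1 zero_le_one (2 * (Real.arccos (height v) / Real.pi) - 1)

theorem continuous_southAngle : Continuous southAngle :=
  continuous_projIcc.comp (by have := continuous_height; fun_prop)

theorem southAngle_of_nonneg {v : S2} (h : 0 ≤ height v) : southAngle v = 0 := by
  refine Set.projIcc_of_le_left _ ?_
  have := Real.arccos_le_pi_div_two.2 h
  have hpi := Real.pi_pos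
  have : Real.arccos (height v) / Real.pi ≤ 1 / 2 := by
    rw [div_le_div_iff₀ hpi two_pos]
    linarith
  linarith

theorem southAngle_south : southAngle southPole = 1 := by
  refine Set.projIcc_of_right_le _ ?_
  rw [height_south, Real.arccos_neg_one, div_self Real.pi_ne_zero]
  norm_num

section Tail

variable {P Y : Type*} [TopologicalSpace P] [TopologicalSpace Y]

/-- Continuity of a family of maps with tails `Γ (s, ·)`; a homotopy of tails is the case `P = I`.
-/
theorem continuous_tail_aux (f : C(S2, Y)) (Γ : C(P × I, Y)) (h : ∀ s, Γ (s, 0) = f southPole) :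
    Continuous fun p : P × S2 =>
      if height p.2 ≤ 0 then Γ (p.1, southAngle p.2) else f (stretch p.2) := by
  have := continuous_height
  have := continuous_southAngle
  refine Continuous.if_le (by fun_prop) (by fun_prop) (by fun_prop) continuous_const ?_
  intro p hp
  rw [southAngle_of_nonneg hp.ge, h, stretch_of_nonpos hp.le]

/-- The map `f` out of the sphere with a tail `γ`: the northern hemisphere is stretched over the
whole sphere and sent to `Y` by `f`, and the southern hemisphere runs along `γ`. -/
def tail (f : C(S2, Y)) {y : Y} (γ : Path (f southPole) y) : C(S2, Y) where
  toFun v := if height v ≤ 0 then γ (southAngle v) else f (stretch v)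
  continuous_toFun :=
    (continuous_tail_aux (P := Unit) f ⟨fun p => γ p.2, by fun_prop⟩ (by simp)).comp
      (Continuous.prodMk_right ())

variable (f : C(S2, Y)) {y : Y} (γ γ' : Path (f southPole) y)

theorem tail_apply (v : S2) :
    tail f γ v = if height v ≤ 0 then γ (southAngle v) else f (stretch v) := rfl

theorem tail_north : tail f γ northPole = f northPole := by
  rw [tail_apply, if_neg (by simp [height_north]), stretch_north]

theorem tail_south : tail f γ southPole = y := by
  rw [tail_apply, if_pos (by simp [height_south]), southAngle_south, γ.target]

theorem comp_tail {Z : Type*} [TopologicalSpace Z] (φ : C(Y, Z)) :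
    φ.comp (tail f γ) = tail (φ.comp f) (γ.map φ.continuous) := by
  ext v
  simp only [comp_apply, tail_apply]
  split_ifs <;> rfl

theorem tail_refl : tail f (Path.refl _) = f.comp stretch := by
  ext v
  rw [tail_apply]
  split_ifs with h
  · simp [stretch_of_nonpos h]
  · rfl

variable {γ γ'} in
theorem tail_homotopicRel (h : γ.Homotopic γ') :
    (tail f γ).HomotopicRel (tail f γ') {northPole, southPole} := by
  obtain ⟨H⟩ := h
  refine ⟨⟨⟨⟨_, continuous_tail_aux f H.toContinuousMap (fun s => ?_)⟩, ?_, ?_⟩, ?_⟩⟩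
  · exact H.source s
  · intro v
    simp [tail_apply]
  · intro v
    simp [tail_apply]
  · rintro t x (rfl | rfl)
    · simp [height_north, tail_north, stretch_north]
    · simp [height_south, tail_south, southAngle_south]

/-- A tail can be retracted along itself, since its end is free. -/
theorem tail_homotopicRel_self : (tail f γ).HomotopicRel f {northPole} := by
  have h1 : (f.comp stretch).HomotopicRel (tail f γ) {northPole} := by
    refine ⟨⟨⟨⟨_, continuous_tail_aux f ⟨fun p : I × I => γ (p.1 * p.2), by fun_prop⟩
      (fun s => by simp)⟩, ?_, ?_⟩, ?_⟩⟩
    · intro v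
      rw [← tail_refl, tail_apply]
      simp
    · intro v
      simp [tail_apply]
    · rintro t x rfl
      simp [height_north]
  have h2 : (f.comp stretch).HomotopicRel f {northPole} := by
    obtain ⟨H⟩ := stretch_homotopicRel_id.comp_continuousMap f
    exact ⟨⟨H.toHomotopy, fun t x hx => H.prop' t x (.inl hx)⟩⟩
  exact h1.symm.trans h2

theorem tail_homotopicRel_of_refl {γ : Path (f southPole) (f southPole)}
    (h : γ.Homotopic (Path.refl _)) : (tail f γ).HomotopicRel f {northPole, southPole} := by
  refine (tail_homotopicRel f h).trans ?_
  rw [tail_refl]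
  exact stretch_homotopicRel_id.comp_continuousMap f

/-- The meridian from the north pole to the south pole, parametrized by the polar angle. -/
def meridian : Path northPole southPole where
  toFun t := ⟨!₂[Real.cos (Real.pi * t), Real.sin (Real.pi * t), 0], by
    rw [mem_sphere_zero_iff_norm, ← sq_eq_sq₀ (norm_nonneg _) zero_le_one, norm_sq_eq]
    simp⟩
  continuous_toFun := by
    refine Continuous.subtype_mk ?_ _
    refine (PiLp.continuous_toLp 2 _).comp (continuous_pi fun i => ?_)
    fin_cases i <;> simp <;> fun_prop
  source' := by
    ext i
    fin_cases i <;> simp [northPole]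
  target' := by
    ext i
    fin_cases i <;> simp [southPole, northPole]

theorem coe_meridian (t : I) :
    (meridian t : E3) = !₂[Real.cos (Real.pi * t), Real.sin (Real.pi * t), 0] := rfl

theorem height_meridian (t : I) : height (meridian t) = Real.cos (Real.pi * t) := rfl

/-- On the meridian, a map with a tail is the concatenation of the map and the tail. -/
theorem tail_meridian : (meridian.map (tail f γ).continuous : I → Y) =
    ((meridian.map f.continuous).trans γ) := by
  ext t
  have hpi := Real.pi_pos
  rw [Path.map_coe, Function.comp_apply, tail_apply, height_meridian, Path.trans_apply]
  have hnn := mul_nonneg hpi.le t.2.1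
  rcases lt_or_ge (t : ℝ) (1 / 2) with h | h
  · have hc : 0 < Real.cos (Real.pi * t) :=
      Real.cos_pos_of_mem_Ioo ⟨by linarith, by nlinarith⟩
    rw [if_neg hc.not_ge, dif_pos h.le, Path.map_coe, Function.comp_apply]
    congr 1
    ext1
    rw [stretch_of_nonneg (by rw [height_meridian]; exact hc.le), height_meridian,
      coe_meridian, coe_meridian]
    have e : Real.pi * (2 * t) = 2 * (Real.pi * t) := by ring
    ext i
    fin_cases i
    · simp [northPole, e, Real.cos_two_mul]
      ring
    · simp [northPole, e, Real.sin_two_mul]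
      ring
    · simp [northPole]
  · have hc : Real.cos (Real.pi * t) ≤ 0 :=
      Real.cos_nonpos_of_pi_div_two_le_of_le (by nlinarith) (by nlinarith [t.2.2])
    have ha : Real.arccos (Real.cos (Real.pi * t)) = Real.pi * t :=
      Real.arccos_cos hnn (by nlinarith [t.2.2])
    have hs : southAngle (meridian t) = Set.projIcc 0 1 zero_le_one (2 * (t : ℝ) - 1) := by
      rw [southAngle, height_meridian, ha, mul_div_cancel_left₀ _ hpi.ne']
    rw [if_pos hc, hs]
    split_ifs with h'
    · have : (t : ℝ) = 1 / 2 := le_antisymm h' h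
      simp [this]
    · rw [Set.projIcc_of_mem]

end Tail

/-! ### Maps out of the circle -/

/-- The standard loop around the circle. -/
def circleLoop : Path (1 : Circle) 1 where
  toFun t := AddCircle.toCircle ((t : ℝ) : AddCircle (1 : ℝ))
  continuous_toFun := AddCircle.continuous_toCircle.comp
    ((AddCircle.continuous_mk' 1).comp continuous_subtype_val)
  source' := by simp
  target' := by simp [AddCircle.coe_period]

section Circle

variable {Y : Type*} [TopologicalSpace Y]

/-- The map out of the circle given by a loop. -/
def circleLift (h : C(I, Y)) (h01 : h 0 = h 1) : C(Circle, Y) where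
  toFun z := AddCircle.liftIco (1 : ℝ) 0 (fun t => h (Set.projIcc 0 1 zero_le_one t))
    ((AddCircle.homeomorphCircle one_ne_zero).symm z)
  continuous_toFun :=
    (AddCircle.liftIco_zero_continuous (by simpa using h01)
      (h.continuous.comp continuous_projIcc).continuousOn).comp (Homeomorph.continuous _)

theorem circleLift_loop (h : C(I, Y)) (h01 : h 0 = h 1) (t : I) :
    circleLift h h01 (circleLoop t) = h t := by
  have e : (AddCircle.homeomorphCircle one_ne_zero).symm (circleLoop t) =
      ((t : ℝ) : AddCircle (1 : ℝ)) := by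
    rw [Homeomorph.symm_apply_eq, AddCircle.homeomorphCircle_apply]
    rfl
  change AddCircle.liftIco (1 : ℝ) 0 (fun t => h (Set.projIcc 0 1 zero_le_one t))
    ((AddCircle.homeomorphCircle one_ne_zero).symm (circleLoop t)) = _
  rw [e]
  rcases t.2.2.lt_or_eq with ht | ht
  · rw [AddCircle.liftIco_zero_coe_apply ⟨t.2.1, ht⟩, Set.projIcc_val]
  · rw [ht, AddCircle.coe_period, ← AddCircle.coe_zero,
      AddCircle.liftIco_zero_coe_apply ⟨le_rfl, one_pos⟩]
    rw [show t = 1 from Subtype.ext ht, ← h01]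
    simp

theorem circleLoop_surjective (z : Circle) : ∃ t, circleLoop t = z := by
  obtain ⟨x, rfl⟩ := (AddCircle.homeomorphCircle (one_ne_zero (α := ℝ))).surjective z
  obtain ⟨t, ht, rfl⟩ := AddCircle.eq_coe_Ico x
  have ht' : t ∈ Set.Ico (0 : ℝ) 1 := by simpa using ht
  refine ⟨⟨t, ht'.1, ht'.2.le⟩, ?_⟩
  rw [AddCircle.homeomorphCircle_apply]
  rfl

/-- A homotopy of loops gives a homotopy of maps out of the circle. -/
theorem homotopicRel_of_loop {F G : C(Circle, Y)} {y : Y} {p q : Path y y} (h : p.Homotopic q)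
    (hF : ∀ t, F (circleLoop t) = p t) (hG : ∀ t, G (circleLoop t) = q t) :
    F.HomotopicRel G {1} := by
  obtain ⟨H⟩ := h
  let K : C(I, C(I, Y)) := (H.toContinuousMap.comp ⟨Prod.swap, continuous_swap⟩).curry
  have hK : ∀ t s, K t s = H (s, t) := fun _ _ => rfl
  have h0 : K 0 = K 1 := by
    ext s
    simp [hK]
  have hL : ∀ t s, circleLift K h0 (circleLoop t) s = H (s, t) := fun t s => by
    rw [circleLift_loop, hK]
  refine ⟨⟨⟨(circleLift K h0).uncurry.comp ⟨Prod.swap, continuous_swap⟩, fun z => ?_, fun z => ?_⟩,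
    fun s z hz => ?_⟩⟩
  · obtain ⟨t, rfl⟩ := circleLoop_surjective z
    exact (hL t 0).trans ((H.apply_zero t).trans (hF t).symm)
  · obtain ⟨t, rfl⟩ := circleLoop_surjective z
    exact (hL t 1).trans ((H.apply_one t).trans (hG t).symm)
  · have hz : z = circleLoop 0 := (show z = 1 from hz).trans circleLoop.source.symm
    subst hz
    exact (hL 0 s).trans ((H.source s).trans ((p.source).symm.trans (hF 0).symm))

end Circle

/-! ### Maps out of the two models -/

section Models

variable {Y : Type*} [TopologicalSpace Y]

namespace PinchedTorus

/-- The inclusion of the first sphere. -/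
def inl : C(S2, PinchedTorus) := ⟨fun v => Quot.mk _ (.inl v), by fun_prop⟩

/-- The inclusion of the second sphere. -/
def inr : C(S2, PinchedTorus) := ⟨fun v => Quot.mk _ (.inr v), by fun_prop⟩

theorem inl_north : inl northPole = north := rfl

theorem inl_south : inl southPole = south := rfl

theorem inr_north : inr northPole = north := (Quot.sound (.inl ⟨rfl, rfl⟩)).symm

theorem inr_south : inr southPole = south := (Quot.sound (.inr ⟨rfl, rfl⟩)).symm

/-- Two maps out of the sphere that agree at the poles, glued to a map out of the pinched torus. -/
def desc (F G : C(S2, Y)) (hN : F northPole = G northPole) (hS : F southPole = G southPole) :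
    C(PinchedTorus, Y) where
  toFun := Quot.lift (Sum.elim F G) (by rintro _ _ (⟨rfl, rfl⟩ | ⟨rfl, rfl⟩) <;> assumption)
  continuous_toFun := continuous_quot_lift _ (by fun_prop)

theorem ind {p : PinchedTorus → Prop} (hl : ∀ v, p (inl v)) (hr : ∀ v, p (inr v)) (x) : p x := by
  rcases x with ⟨v | v⟩
  · exact hl v
  · exact hr v

/-- Homotopies on the two spheres that rest at the poles glue. They are glued as maps to the path
space `C(I, Y)`. -/
theorem homotopic_of_comp {F G : C(PinchedTorus, Y)}
    (hl : (F.comp inl).HomotopicRel (G.comp inl) {northPole, southPole})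
    (hr : (F.comp inr).HomotopicRel (G.comp inr) {northPole, southPole}) : F.Homotopic G := by
  obtain ⟨H⟩ := hl
  obtain ⟨K⟩ := hr
  let H' : C(S2, C(I, Y)) := (H.toContinuousMap.comp ⟨Prod.swap, continuous_swap⟩).curry
  let K' : C(S2, C(I, Y)) := (K.toContinuousMap.comp ⟨Prod.swap, continuous_swap⟩).curry
  let L : C(PinchedTorus, C(I, Y)) := desc H' K'
    (by
      ext t
      exact (H.prop' t northPole (by simp)).trans (Eq.trans (by simp [inl_north, inr_north])
        (K.prop' t northPole (by simp)).symm))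
    (by
      ext t
      exact (H.prop' t southPole (by simp)).trans (Eq.trans (by simp [inl_south, inr_south])
        (K.prop' t southPole (by simp)).symm))
  refine ⟨⟨L.uncurry.comp ⟨Prod.swap, continuous_swap⟩, ?_, ?_⟩⟩
  · exact ind H.apply_zero K.apply_zero
  · exact ind H.apply_one K.apply_one

end PinchedTorus

namespace WedgeS2S2S1

/-- The base point of the wedge sum. -/
def base : WedgeS2S2S1 := Quot.mk _ (.inl northPole)

/-- The inclusion of the first sphere. -/
def inl : C(S2, WedgeS2S2S1) := ⟨fun v => Quot.mk _ (.inl v), by fun_prop⟩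

/-- The inclusion of the second sphere. -/
def inr : C(S2, WedgeS2S2S1) := ⟨fun v => Quot.mk _ (.inr (.inl v)), by fun_prop⟩

/-- The inclusion of the circle. -/
def circ : C(Circle, WedgeS2S2S1) := ⟨fun z => Quot.mk _ (.inr (.inr z)), by fun_prop⟩

theorem inl_north : inl northPole = base := rfl

theorem inr_north : inr northPole = base := (Quot.sound ⟨rfl, .inl rfl⟩).symm

theorem circ_one : circ 1 = base := (Quot.sound ⟨rfl, .inr rfl⟩).symm

/-- Three pointed maps, glued to a map out of the wedge sum. -/
def desc (F G : C(S2, Y)) (K : C(Circle, Y)) (hG : F northPole = G northPole)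
    (hK : F northPole = K 1) : C(WedgeS2S2S1, Y) where
  toFun := Quot.lift (Sum.elim F (Sum.elim G K)) (by rintro _ _ ⟨rfl, rfl | rfl⟩ <;> assumption)
  continuous_toFun := continuous_quot_lift _ (by fun_prop)

theorem ind {p : WedgeS2S2S1 → Prop} (hl : ∀ v, p (inl v)) (hr : ∀ v, p (inr v))
    (hc : ∀ z, p (circ z)) (x) : p x := by
  rcases x with ⟨v | v | z⟩
  · exact hl v
  · exact hr v
  · exact hc z

/-- Pointed homotopies on the three summands glue. -/
theorem homotopic_of_comp {F G : C(WedgeS2S2S1, Y)}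
    (hl : (F.comp inl).HomotopicRel (G.comp inl) {northPole})
    (hr : (F.comp inr).HomotopicRel (G.comp inr) {northPole})
    (hc : (F.comp circ).HomotopicRel (G.comp circ) {1}) : F.Homotopic G := by
  obtain ⟨H⟩ := hl
  obtain ⟨K⟩ := hr
  obtain ⟨M⟩ := hc
  let H' : C(S2, C(I, Y)) := (H.toContinuousMap.comp ⟨Prod.swap, continuous_swap⟩).curry
  let K' : C(S2, C(I, Y)) := (K.toContinuousMap.comp ⟨Prod.swap, continuous_swap⟩).curry
  let M' : C(Circle, C(I, Y)) := (M.toContinuousMap.comp ⟨Prod.swap, continuous_swap⟩).curry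
  let L : C(WedgeS2S2S1, C(I, Y)) := desc H' K' M'
    (by
      ext t
      exact (H.prop' t northPole rfl).trans (Eq.trans (by simp [inl_north, inr_north])
        (K.prop' t northPole rfl).symm))
    (by
      ext t
      exact (H.prop' t northPole rfl).trans (Eq.trans (by simp [inl_north, circ_one])
        (M.prop' t 1 rfl).symm))
  refine ⟨⟨L.uncurry.comp ⟨Prod.swap, continuous_swap⟩, ?_, ?_⟩⟩
  · exact ind H.apply_zero K.apply_zero M.apply_zero
  · exact ind H.apply_one K.apply_one M.apply_one

end WedgeS2S2S1

end Models

/-! ### The pinched torus is a wedge of two spheres and a circle -/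

section PathAlgebra

variable {Y Z : Type*} [TopologicalSpace Y] [TopologicalSpace Z] {x y z : Y}

open Path.Homotopic.Quotient in
theorem Path.Homotopic.symm_trans_trans_symm_trans (p q : Path x y) :
    (p.symm.trans ((p.trans q.symm).trans q)).Homotopic (Path.refl y) := by
  simp [← Path.Homotopic.Quotient.eq]

open Path.Homotopic.Quotient in
theorem Path.Homotopic.symm_trans_refl_trans (p : Path x y) :
    (p.symm.trans ((Path.refl x).trans p)).Homotopic (Path.refl y) := by
  simp [← Path.Homotopic.Quotient.eq]

open Path.Homotopic.Quotient in
theorem Path.Homotopic.trans_symm_trans_trans_symm (p : Path x y) (q : Path x z) (r : Path x x) :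
    ((p.trans (p.symm.trans (r.trans q))).trans q.symm).Homotopic r := by
  simp only [← Path.Homotopic.Quotient.eq, mk_trans, mk_symm, Quotient.trans_assoc,
    Quotient.trans_symm, Quotient.trans_refl]
  rw [← Quotient.trans_assoc, Quotient.trans_symm, Quotient.refl_trans]

theorem Path.apply_trans_eq (φ : Y → Z) {p : Path x y} {q : Path y z} {x' y' z' : Z}
    {p' : Path x' y'} {q' : Path y' z'} (hp : ∀ t, φ (p t) = p' t) (hq : ∀ t, φ (q t) = q' t)
    (t : I) : φ ((p.trans q) t) = (p'.trans q') t := by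
  simp only [Path.trans_apply]
  split_ifs
  · exact hp _
  · exact hq _

/-- A tail that becomes null-homotopic in `Z` can be removed there. -/
theorem comp_tail_homotopicRel {f : C(S2, Y)} {γ : Path (f southPole) y} (φ : C(Y, Z))
    {f' : C(S2, Z)} (hf : φ.comp f = f') {w : Z} {δ : Path w w} (hδ : δ.Homotopic (Path.refl w))
    (h : ∀ t, φ (γ t) = δ t) : (φ.comp (tail f γ)).HomotopicRel f' {northPole, southPole} := by
  subst hf
  have h0 : φ (f southPole) = w := by simpa using h 0
  have h1 : φ y = w := by simpa using h 1
  subst h0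
  have e : φ.comp (tail f γ) = tail (φ.comp f) δ := by
    rw [comp_tail]
    ext v
    simp only [tail_apply, ← h]
    rfl
  rw [e]
  exact tail_homotopicRel_of_refl _ hδ

end PathAlgebra

namespace PinchedTorus

/-- The meridian of the first sphere. -/
def meridianL : Path north south := meridian.map inl.continuous

/-- The meridian of the second sphere. -/
def meridianR : Path north south :=
  (meridian.map inr.continuous).cast inr_north.symm inr_south.symm

/-- The loop that descends on the second sphere and climbs back on the first one. -/
def pinchLoop : Path north north := meridianR.trans meridianL.symm

end PinchedTorus

namespace WedgeS2S2S1

/-- The meridian of the first sphere. -/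
def meridianL : Path base (inl southPole) := meridian.map inl.continuous

/-- The meridian of the second sphere. -/
def meridianR : Path base (inr southPole) := (meridian.map inr.continuous).cast inr_north.symm rfl

/-- The loop around the circle. -/
def loop : Path base base := (circleLoop.map circ.continuous).cast circ_one.symm circ_one.symm

/-- The path from the south pole of the second sphere to that of the first one that runs once around
the circle. -/
def bridge : Path (inr southPole) (inl southPole) := meridianR.symm.trans (loop.trans meridianL)

end WedgeS2S2S1

/-- The identity on the first sphere; the second sphere gets a tail through the circle to the
south pole of the first one. -/
def pinchedToWedge : C(PinchedTorus, WedgeS2S2S1) :=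
  PinchedTorus.desc WedgeS2S2S1.inl (tail WedgeS2S2S1.inr WedgeS2S2S1.bridge)
    (by rw [tail_north, WedgeS2S2S1.inl_north, WedgeS2S2S1.inr_north]) (by rw [tail_south])

theorem pinchLoop_closed : PinchedTorus.pinchLoop.toContinuousMap 0 =
    PinchedTorus.pinchLoop.toContinuousMap 1 := by simp

/-- The identity on the two spheres; the circle runs through both pinch points. -/
def wedgeToPinched : C(WedgeS2S2S1, PinchedTorus) :=
  WedgeS2S2S1.desc PinchedTorus.inl PinchedTorus.inr
    (circleLift PinchedTorus.pinchLoop.toContinuousMap pinchLoop_closed)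
    (by rw [PinchedTorus.inl_north, PinchedTorus.inr_north])
    (by
      rw [PinchedTorus.inl_north, ← circleLoop.source, circleLift_loop]
      simp)

theorem wedgeToPinched_loop (t : I) :
    wedgeToPinched (WedgeS2S2S1.loop t) = PinchedTorus.pinchLoop t :=
  circleLift_loop PinchedTorus.pinchLoop.toContinuousMap pinchLoop_closed t

theorem wedgeToPinched_comp_pinchedToWedge :
    (wedgeToPinched.comp pinchedToWedge).Homotopic (ContinuousMap.id PinchedTorus) := by
  refine PinchedTorus.homotopic_of_comp (ContinuousMap.HomotopicRel.refl _) ?_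
  refine comp_tail_homotopicRel wedgeToPinched (f := WedgeS2S2S1.inr) (f' := PinchedTorus.inr)
    (γ := WedgeS2S2S1.bridge) rfl
    (Path.Homotopic.symm_trans_trans_symm_trans PinchedTorus.meridianR PinchedTorus.meridianL) ?_
  exact Path.apply_trans_eq _ (fun _ => rfl)
    (Path.apply_trans_eq _ wedgeToPinched_loop fun _ => rfl)

theorem pinchedToWedge_comp_wedgeToPinched :
    (pinchedToWedge.comp wedgeToPinched).Homotopic (ContinuousMap.id WedgeS2S2S1) := by
  refine WedgeS2S2S1.homotopic_of_comp (ContinuousMap.HomotopicRel.refl _)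
    (tail_homotopicRel_self WedgeS2S2S1.inr WedgeS2S2S1.bridge) ?_
  refine homotopicRel_of_loop (Path.Homotopic.trans_symm_trans_trans_symm WedgeS2S2S1.meridianR
    WedgeS2S2S1.meridianL WedgeS2S2S1.loop) (fun t => ?_) (fun _ => rfl)
  have h : (pinchedToWedge.comp wedgeToPinched).comp WedgeS2S2S1.circ (circleLoop t) =
      pinchedToWedge (PinchedTorus.pinchLoop t) := congrArg pinchedToWedge (wedgeToPinched_loop t)
  rw [h]
  refine Path.apply_trans_eq _ (fun s => ?_) (fun _ => rfl) t
  exact congrFun (tail_meridian WedgeS2S2S1.inr WedgeS2S2S1.bridge) s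

/-- The pinched torus is homotopy equivalent to the wedge of two spheres and a circle. -/
def pinchedEquivWedge : PinchedTorus ≃ₕ WedgeS2S2S1 where
  toFun := pinchedToWedge
  invFun := wedgeToPinched
  left_inv := wedgeToPinched_comp_pinchedToWedge
  right_inv := pinchedToWedge_comp_wedgeToPinched

theorem fold_homotopic_fold_comp :
    PinchedTorus.fold.Homotopic (WedgeS2S2S1.fold.comp pinchedToWedge) := by
  refine ContinuousMap.Homotopic.symm ?_
  refine PinchedTorus.homotopic_of_comp (ContinuousMap.HomotopicRel.refl _) ?_
  refine comp_tail_homotopicRel WedgeS2S2S1.fold (f := WedgeS2S2S1.inr) (f' := ContinuousMap.id S2)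
    (γ := WedgeS2S2S1.bridge) rfl (Path.Homotopic.symm_trans_refl_trans meridian) ?_
  have h := Path.apply_trans_eq WedgeS2S2S1.fold (p := WedgeS2S2S1.loop)
    (q := WedgeS2S2S1.meridianL) (p' := Path.refl northPole) (q' := meridian) (fun _ => rfl)
    (fun _ => rfl)
  exact Path.apply_trans_eq WedgeS2S2S1.fold (p := WedgeS2S2S1.meridianR.symm)
    (p' := meridian.symm) (fun _ => rfl) h

/-! ### Estimates for the path metric -/

section PathMetric

variable {X : Type*} [MetricSpace X] {S : Set X}

theorem PathSpace.dist_def (a b : PathSpace S) :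
    dist a b = (min (pathEDist S a.pt b.pt) 1).toReal := rfl

theorem PathSpace.dist_le_of_pathEDist_le {a b : PathSpace S} {K : ℝ} (hK : 0 ≤ K)
    (h : pathEDist S a.pt b.pt ≤ ENNReal.ofReal K) : dist a b ≤ K := by
  rw [PathSpace.dist_def]
  exact ENNReal.toReal_le_of_le_ofReal hK ((min_le_left _ _).trans h)

theorem PathSpace.dist_le_of_lipschitz {a b : PathSpace S} {c : I → X} (hc : ∀ t, c t ∈ S)
    (h0 : c 0 = a.pt) (h1 : c 1 = b.pt) {K : NNReal} (hK : LipschitzWith K c) : dist a b ≤ K := by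
  refine PathSpace.dist_le_of_pathEDist_le K.2 ?_
  let γ : Path a.pt b.pt :=
    { toFun := fun t => ⟨c t, hc t⟩
      continuous_toFun := hK.continuous.subtype_mk _
      source' := Subtype.ext h0
      target' := Subtype.ext h1 }
  refine (iInf_le _ γ).trans ?_
  have h2 : eVariationOn (fun t : I => (t : ℝ)) Set.univ ≤ 1 := by
    have h := MonotoneOn.eVariationOn_eq (f := fun t : I => (t : ℝ)) (s := Set.univ) (a := 0)
      (b := 1) (fun _ _ _ _ h => h) trivial trivial
    have hI : (Set.Icc 0 1 : Set I) = Set.univ := Set.eq_univ_of_forall fun x => ⟨x.2.1, x.2.2⟩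
    rw [Set.univ_inter, hI] at h
    simp [h]
  let c' : ℝ → X := fun t => c (Set.projIcc 0 1 zero_le_one t)
  have hc' : LipschitzWith K c' := by
    have := hK.comp (LipschitzWith.projIcc (zero_le_one (α := ℝ)))
    rwa [mul_one] at this
  have h3 := (hc'.lipschitzOnWith (s := Set.univ)).comp_eVariationOn_le
    (f := c') (g := fun t : I => (t : ℝ)) (s := Set.univ) (fun _ _ => trivial)
  have h4 : (fun t : I => ((γ t : S) : X)) = c' ∘ fun t : I => (t : ℝ) := by
    ext t
    simp [c', γ]
  rw [h4]
  refine h3.trans ((mul_le_mul_right h2 _).trans ?_)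
  simp

/-- Points at distance less than `δ ≤ 1` are joined by a path of diameter less than `δ`. -/
theorem PathSpace.exists_path_of_dist_lt {a b : PathSpace S} {δ : ℝ} (hδ : δ ≤ 1)
    (h : dist a b < δ) : ∃ γ : Path a.pt b.pt, ∀ s t, dist (γ s : X) (γ t) < δ := by
  have hpos : 0 < δ := dist_nonneg.trans_lt h
  rw [PathSpace.dist_def, ← ENNReal.lt_ofReal_iff_toReal_lt
    ((min_le_right _ _).trans_lt ENNReal.one_lt_top).ne, min_lt_iff] at h
  have h1 : pathEDist S a.pt b.pt < ENNReal.ofReal δ := by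
    refine h.resolve_right fun h' => ?_
    have := ENNReal.ofReal_le_one.2 hδ
    exact absurd h' this.not_gt
  obtain ⟨γ, hγ⟩ := iInf_lt_iff.1 h1
  refine ⟨γ, fun s t => ?_⟩
  have h2 := (eVariationOn.edist_le (fun t : I => (γ t : X)) (Set.mem_univ s)
    (Set.mem_univ t)).trans_lt hγ
  rwa [edist_dist, ENNReal.ofReal_lt_ofReal_iff hpos] at h2

/-- A `1`-Lipschitz map of `X` that preserves `S` does not increase the path metric. -/
theorem PathSpace.dist_map_le {f : X → X} (hf : LipschitzWith 1 f) (hS : ∀ x ∈ S, f x ∈ S)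
    (a b : PathSpace S) :
    dist (⟨⟨f a.pt, hS _ a.pt.2⟩⟩ : PathSpace S) ⟨⟨f b.pt, hS _ b.pt.2⟩⟩ ≤ dist a b := by
  rw [PathSpace.dist_def, PathSpace.dist_def]
  refine ENNReal.toReal_mono ((min_le_right _ _).trans_lt ENNReal.one_lt_top).ne
    (min_le_min_right _ (le_iInf fun γ => ?_))
  let F : S → S := fun x => ⟨f x, hS x x.2⟩
  have hF : Continuous F := (hf.continuous.comp continuous_subtype_val).subtype_mk _
  refine (iInf_le _ (γ.map hF)).trans ?_
  have h := (hf.lipschitzOnWith (s := Set.univ)).comp_eVariationOn_le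
    (g := fun t : I => (γ t : X)) (s := Set.univ) (fun _ _ => trivial)
  rw [ENNReal.coe_one, one_mul] at h
  exact h

end PathMetric

/-! ### Oriented lines disjoint from the axis -/

namespace OrientedLine

/-- The line with direction `v` and nearest point `x`. -/
def mk (v x : E3) (hv : ‖v‖ = 1) (hx : inner ℝ x v = 0) : OrientedLine :=
  ⟨WithLp.toLp 2 (v, x), hv, hx⟩

theorem continuous_direction : Continuous direction := by
  unfold direction
  fun_prop

theorem continuous_foot : Continuous foot := by
  unfold foot
  fun_prop

theorem ext_iff' {l m : OrientedLine} : l = m ↔ l.direction = m.direction ∧ l.foot = m.foot := by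
  refine ⟨fun h => h ▸ ⟨rfl, rfl⟩, fun ⟨h1, h2⟩ => ?_⟩
  have h1' : l.1.fst = m.1.fst := congrArg Subtype.val h1
  refine Subtype.ext ?_
  apply (WithLp.equiv 2 (E3 × E3)).injective
  exact Prod.ext h1' h2

theorem dist_eq (l m : OrientedLine) :
    dist l m = √(dist l.direction m.direction ^ 2 + dist l.foot m.foot ^ 2) := by
  rw [Subtype.dist_eq, WithLp.prod_dist_eq_of_L2]
  rfl

theorem dist_direction_le (l m : OrientedLine) : dist l.direction m.direction ≤ dist l m := by
  rw [dist_eq]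
  exact Real.le_sqrt_of_sq_le (le_add_of_nonneg_right (sq_nonneg _))

theorem dist_le_add (l m : OrientedLine) :
    dist l m ≤ dist l.direction m.direction + dist l.foot m.foot := by
  rw [dist_eq]
  refine Real.sqrt_le_iff.2 ⟨by positivity, ?_⟩
  nlinarith [mul_nonneg (dist_nonneg (x := l.direction) (y := m.direction))
    (dist_nonneg (x := l.foot) (y := m.foot))]

/-- The line `l` moved towards the origin by the factor `r`. -/
def scale (r : ℝ) (l : OrientedLine) : OrientedLine :=
  mk l.direction (r • l.foot) (by simp) (by rw [inner_smul_left]; simp [foot, direction, l.2.2])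

theorem direction_scale (r : ℝ) (l : OrientedLine) : (scale r l).direction = l.direction := rfl

theorem foot_scale (r : ℝ) (l : OrientedLine) : (scale r l).foot = r • l.foot := rfl

theorem continuous_scale : Continuous fun p : ℝ × OrientedLine => scale p.1 p.2 := by
  have := continuous_direction
  have := continuous_foot
  refine Continuous.subtype_mk ((WithLp.prod_continuous_toLp 2 E3 E3).comp ?_) _
  fun_prop

theorem scale_one (l : OrientedLine) : scale 1 l = l := by
  rw [ext_iff', direction_scale, foot_scale, one_smul]
  exact ⟨rfl, rfl⟩

theorem scale_zero (l : OrientedLine) : scale 0 l = throughOrigin l.direction := by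
  rw [ext_iff', direction_scale, foot_scale, zero_smul]
  exact ⟨rfl, rfl⟩

theorem lipschitzWith_scale {r : ℝ} (h0 : 0 ≤ r) (h1 : r ≤ 1) : LipschitzWith 1 (scale r) := by
  refine LipschitzWith.of_dist_le_mul fun l m => ?_
  rw [NNReal.coe_one, one_mul, dist_eq, dist_eq, direction_scale, direction_scale, foot_scale,
    foot_scale, dist_smul₀, Real.norm_of_nonneg h0]
  gcongr
  exact mul_le_of_le_one_left dist_nonneg h1

/-- The determinant of `e₁`, the direction and the foot, which measures how a line passes by the
`x`-axis. -/
def chirality (l : OrientedLine) : ℝ :=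
  (l.direction : E3) 1 * l.foot 2 - (l.direction : E3) 2 * l.foot 1

theorem continuous_chirality : Continuous chirality := by
  have := continuous_direction
  have := continuous_foot
  unfold chirality
  fun_prop

theorem chirality_scale (r : ℝ) (l : OrientedLine) : (scale r l).chirality = r * l.chirality := by
  simp [chirality, direction_scale, foot_scale]
  ring

/-- A line is disjoint from the `x`-axis when no point of it has both transversal coordinates `0`.
-/
theorem mem_reduced_iff (l : OrientedLine) : l ∈ reducedTwoLineEmb ↔
    ∀ s : ℝ, ¬ (l.foot 1 + s * (l.direction : E3) 1 = 0 ∧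
      l.foot 2 + s * (l.direction : E3) 2 = 0) := by
  change Disjoint xAxis.points l.points ↔ _
  rw [Set.disjoint_left]
  have hx : ∀ s : ℝ, xAxis.foot + s • (xAxis.direction : E3) = s • (northPole : E3) := fun s =>
    zero_add _
  constructor
  · rintro h s ⟨h1, h2⟩
    refine h ⟨(l.foot + s • (l.direction : E3)) 0, ?_⟩ ⟨s, rfl⟩
    change xAxis.foot + _ • (xAxis.direction : E3) = _
    rw [hx]
    ext i
    fin_cases i
    · simp [northPole]
    · simpa [northPole] using h1.symm
    · simpa [northPole] using h2.symm
  · rintro h _ ⟨t, rfl⟩ ⟨s, hs⟩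
    have hs' : l.foot + s • (l.direction : E3) = t • (northPole : E3) := hs.trans (hx t)
    refine h s ⟨?_, ?_⟩
    · simpa [northPole] using congrArg (fun u : E3 => u 1) hs'
    · simpa [northPole] using congrArg (fun u : E3 => u 2) hs'

theorem mem_reduced_of_chirality_ne {l : OrientedLine} (h : l.chirality ≠ 0) :
    l ∈ reducedTwoLineEmb := by
  rw [mem_reduced_iff]
  rintro s ⟨h1, h2⟩
  apply h
  unfold chirality
  linear_combination (l.direction : E3) 1 * h2 - (l.direction : E3) 2 * h1

theorem mem_reduced_of_parallel {l : OrientedLine} (h1 : (l.direction : E3) 1 = 0)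
    (h2 : (l.direction : E3) 2 = 0) (h : ¬ (l.foot 1 = 0 ∧ l.foot 2 = 0)) :
    l ∈ reducedTwoLineEmb := by
  rw [mem_reduced_iff]
  simpa [h1, h2] using h

theorem parallel_of_chirality_eq_zero {l : OrientedLine} (hl : l ∈ reducedTwoLineEmb)
    (h : l.chirality = 0) : (l.direction : E3) 1 = 0 ∧ (l.direction : E3) 2 = 0 := by
  rw [mem_reduced_iff] at hl
  unfold chirality at h
  by_contra hc
  rw [not_and_or] at hc
  rcases hc with hc | hc
  · apply hl (-l.foot 1 / (l.direction : E3) 1)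
    constructor
    · field_simp
      ring
    · field_simp
      linear_combination h
  · apply hl (-l.foot 2 / (l.direction : E3) 2)
    constructor
    · field_simp
      linear_combination -h
    · field_simp
      ring

theorem foot_ne_of_parallel {l : OrientedLine} (hl : l ∈ reducedTwoLineEmb)
    (h1 : (l.direction : E3) 1 = 0) (h2 : (l.direction : E3) 2 = 0) :
    ¬ (l.foot 1 = 0 ∧ l.foot 2 = 0) := by
  rw [mem_reduced_iff] at hl
  simpa [h1, h2] using hl 0

theorem scale_mem_reduced {r : ℝ} (hr : r ≠ 0) {l : OrientedLine} (hl : l ∈ reducedTwoLineEmb) :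
    scale r l ∈ reducedTwoLineEmb := by
  rw [mem_reduced_iff] at *
  rintro s ⟨h1, h2⟩
  rw [direction_scale, foot_scale] at h1 h2
  refine hl (s / r) ⟨?_, ?_⟩
  · field_simp
    simpa [mul_comm] using h1
  · field_simp
    simpa [mul_comm] using h2

end OrientedLine

/-! ### Moving the second line towards the origin -/

/-- The reduced configuration space with its path metric. -/
abbrev Cfg : Type := PathSpace reducedTwoLineEmb

namespace Cfg

/-- The direction of the second line. -/
def dir (a : Cfg) : S2 := (a.pt : OrientedLine).direction

/-- The nearest point of the second line. -/
def foot (a : Cfg) : E3 := (a.pt : OrientedLine).foot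

/-- The configuration moved towards the origin by the factor `r`. -/
def scale (r : Set.Ioc (0 : ℝ) 1) (a : Cfg) : Cfg :=
  ⟨⟨OrientedLine.scale r a.pt, OrientedLine.scale_mem_reduced r.2.1.ne' a.pt.2⟩⟩

theorem lipschitzWith_scale (r : Set.Ioc (0 : ℝ) 1) : LipschitzWith 1 (scale r) :=
  LipschitzWith.of_dist_le_mul fun a b => by
    rw [NNReal.coe_one, one_mul]
    exact PathSpace.dist_map_le (OrientedLine.lipschitzWith_scale r.2.1.le r.2.2)
      (fun x hx => OrientedLine.scale_mem_reduced r.2.1.ne' hx) a b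

/-- A curve of configurations bounds the distance between its end points after scaling. -/
theorem dist_scale_le {a b : Cfg} {c : I → OrientedLine} (hc : ∀ t, c t ∈ reducedTwoLineEmb)
    (h0 : c 0 = a.pt) (h1 : c 1 = b.pt) {K L : NNReal}
    (hK : LipschitzWith K fun t => (c t).direction) (hL : LipschitzWith L fun t => (c t).foot)
    (r : Set.Ioc (0 : ℝ) 1) : dist (scale r a) (scale r b) ≤ K + r * L := by
  have hr : (0 : ℝ) ≤ r := r.2.1.le
  have hcr : LipschitzWith (K + Real.toNNReal r * L) fun t => OrientedLine.scale r (c t) := by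
    refine LipschitzWith.of_dist_le_mul fun s t => ?_
    refine (OrientedLine.dist_le_add _ _).trans ?_
    rw [OrientedLine.direction_scale, OrientedLine.direction_scale, OrientedLine.foot_scale,
      OrientedLine.foot_scale, dist_smul₀, Real.norm_of_nonneg hr]
    have e1 := hK.dist_le_mul s t
    have e2 := mul_le_mul_of_nonneg_left (hL.dist_le_mul s t) hr
    rw [NNReal.coe_add, NNReal.coe_mul, Real.coe_toNNReal _ hr]
    linarith
  have h := PathSpace.dist_le_of_lipschitz (a := scale r a) (b := scale r b)
    (fun t => OrientedLine.scale_mem_reduced r.2.1.ne' (hc t)) (by rw [h0]; rfl)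
    (by rw [h1]; rfl) hcr
  rwa [NNReal.coe_add, NNReal.coe_mul, Real.coe_toNNReal _ hr] at h

theorem dist_scale_scale_le (r s : Set.Ioc (0 : ℝ) 1) (a : Cfg) :
    dist (scale r a) (scale s a) ≤ |(r : ℝ) - s| * ‖a.foot‖ := by
  have hL : LipschitzWith (⟨|(r : ℝ) - s| * ‖a.foot‖, by positivity⟩)
      fun t : I => OrientedLine.scale (r + t * ((s : ℝ) - r)) (a.pt : OrientedLine) := by
    refine LipschitzWith.of_dist_le_mul fun t u => ?_
    rw [OrientedLine.dist_eq, OrientedLine.direction_scale, OrientedLine.direction_scale,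
      dist_self, OrientedLine.foot_scale, OrientedLine.foot_scale, zero_pow two_ne_zero, zero_add,
      Real.sqrt_sq dist_nonneg, dist_eq_norm, ← sub_smul, norm_smul]
    have e : ((r : ℝ) + t * ((s : ℝ) - r)) - (r + u * ((s : ℝ) - r)) =
        ((t : ℝ) - u) * (s - r) := by ring
    rw [e, norm_mul, Real.norm_eq_abs, Real.norm_eq_abs, Subtype.dist_eq, Real.dist_eq,
      abs_sub_comm (s : ℝ) r]
    refine le_of_eq ?_
    change |(t : ℝ) - u| * |(r : ℝ) - s| * ‖a.foot‖ = (|(r : ℝ) - s| * ‖a.foot‖) * |(t : ℝ) - u|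
    ring
  refine PathSpace.dist_le_of_lipschitz (fun t => ?_) (by simp; rfl) (by simp; rfl) hL
  refine OrientedLine.scale_mem_reduced (ne_of_gt ?_) a.pt.2
  have hr := r.2.1
  have hs := s.2.1
  have e : (r : ℝ) + t * ((s : ℝ) - r) = (1 - (t : ℝ)) * r + t * s := by ring
  rw [e]
  rcases t.2.1.eq_or_lt with h | h
  · rw [← h]
    simpa using hr
  · have := mul_nonneg (sub_nonneg.2 t.2.2) hr.le
    have := mul_pos h hs
    linarith

end Cfg

namespace CompletedTwoLines

open UniformSpace Filter Topology

/-- The extension of the scaling to the completion. -/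
def scale (r : Set.Ioc (0 : ℝ) 1) : CompletedTwoLines → CompletedTwoLines :=
  Completion.map (Cfg.scale r)

theorem lipschitzWith_scale (r : Set.Ioc (0 : ℝ) 1) : LipschitzWith 1 (scale r) :=
  (Cfg.lipschitzWith_scale r).completion_map

theorem scale_coe (r : Set.Ioc (0 : ℝ) 1) (a : Cfg) :
    scale r (a : CompletedTwoLines) = (Cfg.scale r a : CompletedTwoLines) :=
  Completion.map_coe (Cfg.lipschitzWith_scale r).uniformContinuous a

theorem secondLine_scale (r : Set.Ioc (0 : ℝ) 1) (c : CompletedTwoLines) :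
    secondLine (scale r c) = OrientedLine.scale r (secondLine c) := by
  refine Completion.induction_on c (isClosed_eq ?_ ?_) fun a => ?_
  · exact secondLine.continuous.comp (lipschitzWith_scale r).continuous
  · exact OrientedLine.continuous_scale.comp (continuous_const.prodMk secondLine.continuous)
  · rw [scale_coe, secondLine_coe, secondLine_coe]
    rfl

/-- The distance from the origin to the second line. -/
def radius (c : CompletedTwoLines) : ℝ := ‖(secondLine c).foot‖

theorem continuous_radius : Continuous radius :=
  (OrientedLine.continuous_foot.comp secondLine.continuous).norm

theorem dist_scale_scale_le (r s : Set.Ioc (0 : ℝ) 1) (c : CompletedTwoLines) :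
    dist (scale r c) (scale s c) ≤ |(r : ℝ) - s| * radius c := by
  refine Completion.induction_on c (isClosed_le ?_ ?_) fun a => ?_
  · exact (lipschitzWith_scale r).continuous.dist (lipschitzWith_scale s).continuous
  · exact continuous_const.mul continuous_radius
  · rw [scale_coe, scale_coe, Completion.dist_eq, radius, secondLine_coe]
    exact Cfg.dist_scale_scale_le r s a

/-- Positive scaling factors that converge to `t`. -/
def approx (t : I) (n : ℕ) : Set.Ioc (0 : ℝ) 1 :=
  ⟨max t ((1 / 2) ^ n), lt_max_of_lt_right (by positivity),
    max_le t.2.2 (pow_le_one₀ (by norm_num) (by norm_num))⟩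

theorem tendsto_approx (t : I) : Tendsto (fun n => (approx t n : ℝ)) atTop (𝓝 t) := by
  have h : Tendsto (fun n : ℕ => ((1 : ℝ) / 2) ^ n) atTop (𝓝 0) :=
    tendsto_pow_atTop_nhds_zero_of_lt_one (by norm_num) (by norm_num)
  have := (tendsto_const_nhds (x := (t : ℝ))).max h
  rwa [max_eq_left t.2.1] at this

theorem cauchySeq_scale_approx (t : I) (c : CompletedTwoLines) :
    CauchySeq fun n => scale (approx t n) c := by
  have h1 := (tendsto_approx t).cauchySeq
  rw [cauchySeq_iff_tendsto_dist_atTop_0] at *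
  refine squeeze_zero (fun _ => dist_nonneg) (fun n => dist_scale_scale_le _ _ c) ?_
  simpa [Real.dist_eq] using h1.mul_const (radius c)

/-- The scaling by `t ∈ [0, 1]` on the completion. For `t = 0` it is a limit of scalings by positive
factors, which act on configurations. -/
def shrink (t : I) (c : CompletedTwoLines) : CompletedTwoLines :=
  (cauchySeq_tendsto_of_complete (cauchySeq_scale_approx t c)).choose

theorem tendsto_shrink (t : I) (c : CompletedTwoLines) :
    Tendsto (fun n => scale (approx t n) c) atTop (𝓝 (shrink t c)) :=
  (cauchySeq_tendsto_of_complete (cauchySeq_scale_approx t c)).choose_spec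

theorem dist_shrink_left_le (t s : I) (c : CompletedTwoLines) :
    dist (shrink t c) (shrink s c) ≤ |(t : ℝ) - s| * radius c :=
  le_of_tendsto_of_tendsto' ((tendsto_shrink t c).dist (tendsto_shrink s c))
    (((tendsto_approx t).sub (tendsto_approx s)).abs.mul_const _)
    fun _ => dist_scale_scale_le _ _ c

theorem dist_shrink_right_le (t : I) (c d : CompletedTwoLines) :
    dist (shrink t c) (shrink t d) ≤ dist c d :=
  le_of_tendsto' ((tendsto_shrink t c).dist (tendsto_shrink t d)) fun n => by
    simpa using (lipschitzWith_scale (approx t n)).dist_le_mul c d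

theorem lipschitzWith_shrink (t : I) : LipschitzWith 1 (shrink t) :=
  LipschitzWith.of_dist_le_mul fun c d => by
    rw [NNReal.coe_one, one_mul]
    exact dist_shrink_right_le t c d

theorem continuous_shrink : Continuous fun p : I × CompletedTwoLines => shrink p.1 p.2 := by
  rw [continuous_iff_continuousAt]
  rintro ⟨t, c⟩
  rw [ContinuousAt, tendsto_iff_dist_tendsto_zero]
  refine squeeze_zero (g := fun p : I × CompletedTwoLines =>
    dist p.2 c + |(p.1 : ℝ) - t| * radius c) (fun _ => dist_nonneg) (fun p => ?_) ?_
  · exact (dist_triangle _ (shrink p.1 c) _).trans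
      (add_le_add (dist_shrink_right_le _ _ _) (dist_shrink_left_le _ _ _))
  · have : Continuous fun p : I × CompletedTwoLines =>
        dist p.2 c + |(p.1 : ℝ) - t| * radius c := by fun_prop
    simpa using this.tendsto (t, c)

theorem secondLine_shrink (t : I) (c : CompletedTwoLines) :
    secondLine (shrink t c) = OrientedLine.scale t (secondLine c) := by
  refine tendsto_nhds_unique ((secondLine.continuous.tendsto _).comp (tendsto_shrink t c)) ?_
  have h : Continuous fun r : ℝ => OrientedLine.scale r (secondLine c) :=
    OrientedLine.continuous_scale.comp (continuous_id.prodMk continuous_const)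
  refine ((h.tendsto t).comp (tendsto_approx t)).congr fun n => ?_
  exact (secondLine_scale _ c).symm

theorem shrink_one (c : CompletedTwoLines) : shrink 1 c = c := by
  have h1 : ∀ n, approx 1 n = ⟨1, one_pos, le_rfl⟩ := fun n =>
    Subtype.ext (max_eq_left (pow_le_one₀ (by norm_num) (by norm_num)))
  have h := tendsto_shrink 1 c
  simp only [h1] at h
  rw [tendsto_nhds_unique h tendsto_const_nhds]
  refine Completion.induction_on c (isClosed_eq (lipschitzWith_scale _).continuous continuous_id)
    fun a => ?_
  rw [scale_coe]
  congr 1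
  exact congrArg PathSpace.mk (Subtype.ext (OrientedLine.scale_one _))

/-- In the limit only the direction contributes to the length of a curve. -/
theorem dist_shrink_zero_le {a b : Cfg} {c : I → OrientedLine} (hc : ∀ t, c t ∈ reducedTwoLineEmb)
    (h0 : c 0 = a.pt) (h1 : c 1 = b.pt) {K L : NNReal}
    (hK : LipschitzWith K fun t => (c t).direction) (hL : LipschitzWith L fun t => (c t).foot) :
    dist (shrink 0 (a : CompletedTwoLines)) (shrink 0 (b : CompletedTwoLines)) ≤ K := by
  have h := (tendsto_approx 0).mul_const (L : ℝ)
  have h' := h.const_add (K : ℝ)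
  simp only [Set.Icc.coe_zero, zero_mul, add_zero] at h'
  refine le_of_tendsto_of_tendsto' ((tendsto_shrink 0 _).dist (tendsto_shrink 0 _)) h' fun n => ?_
  rw [scale_coe, scale_coe, Completion.dist_eq]
  exact Cfg.dist_scale_le hc h0 h1 hK hL _

end CompletedTwoLines

/-! ### The two sections over the sphere of directions -/

theorem norm_normalize_sub_normalize_le {E : Type*} [NormedAddCommGroup E] [NormedSpace ℝ E]
    {u w : E} (hu : 1 / 2 ≤ ‖u‖) (hw : w ≠ 0) :
    ‖‖u‖⁻¹ • u - ‖w‖⁻¹ • w‖ ≤ 4 * ‖u - w‖ := by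
  have hu0 : 0 < ‖u‖ := by linarith
  have hw0 : 0 < ‖w‖ := norm_pos_iff.2 hw
  have e : ‖u‖⁻¹ • u - ‖w‖⁻¹ • w = ‖u‖⁻¹ • (u - w) + (‖u‖⁻¹ * (‖w‖ - ‖u‖)) • (‖w‖⁻¹ • w) := by
    rw [smul_sub, smul_smul, mul_sub, sub_mul, inv_mul_cancel₀ hu0.ne', mul_assoc,
      mul_inv_cancel₀ hw0.ne', mul_one, one_mul, sub_smul]
    abel
  have h1 : ‖‖w‖⁻¹ • w‖ = 1 := by
    rw [norm_smul, norm_inv, norm_norm, inv_mul_cancel₀ hw0.ne']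
  have h2 : |‖w‖ - ‖u‖| ≤ ‖u - w‖ := by
    rw [norm_sub_rev]
    exact abs_norm_sub_norm_le w u
  have h3 : ‖u‖⁻¹ ≤ 2 := by
    rw [inv_le_comm₀ hu0 two_pos]
    linarith
  rw [e]
  refine (norm_add_le _ _).trans ?_
  rw [norm_smul, norm_smul, h1, mul_one, norm_mul, norm_inv, norm_norm, Real.norm_eq_abs]
  have h4 : ‖u‖⁻¹ * |‖w‖ - ‖u‖| ≤ 2 * ‖u - w‖ :=
    mul_le_mul h3 h2 (abs_nonneg _) two_pos.le
  have h5 : ‖u‖⁻¹ * ‖u - w‖ ≤ 2 * ‖u - w‖ := mul_le_mul_of_nonneg_right h3 (norm_nonneg _)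
  linarith

/-- A direction is polar if it is parallel to the `x`-axis. -/
def IsPolar (v : S2) : Prop := (v : E3) 1 = 0 ∧ (v : E3) 2 = 0

theorem isPolar_iff {v : S2} : IsPolar v ↔ v = northPole ∨ v = southPole := by
  constructor
  · rintro ⟨h1, h2⟩
    have h := S2_sq v
    rw [h1, h2] at h
    have h' : (height v - 1) * (height v + 1) = 0 := by
      unfold height
      linear_combination h
    rcases mul_eq_zero.1 h' with h' | h'
    · exact .inl (eq_north_of_height (by linarith))
    · exact .inr (eq_south_of_height (by linarith))
  · rintro (rfl | rfl) <;> simp [IsPolar, northPole, southPole]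

theorem IsPolar.eq_of_dist_lt {v w : S2} (hv : IsPolar v) (hw : IsPolar w) (h : dist v w < 2) :
    v = w := by
  have hd : dist northPole southPole = 2 := by
    rw [Subtype.dist_eq, dist_eq_norm, southPole]
    have : (northPole : E3) - (-northPole : S2) = (2 : ℝ) • (northPole : E3) := by
      simp [two_smul]
    rw [this, norm_smul]
    simp
  rcases isPolar_iff.1 hv with rfl | rfl <;> rcases isPolar_iff.1 hw with rfl | rfl
  · rfl
  · exact absurd hd h.ne
  · rw [dist_comm] at h
    exact absurd hd h.ne
  · rfl

namespace Cfg

open OrientedLine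

theorem norm_dir (a : Cfg) : ‖(a.dir : E3)‖ = 1 := by simp

/-- The chirality of the second line. -/
def chirality (a : Cfg) : ℝ := (a.pt : OrientedLine).chirality

theorem chirality_eq (a : Cfg) :
    a.chirality = (a.dir : E3) 1 * a.foot 2 - (a.dir : E3) 2 * a.foot 1 := rfl

theorem isPolar_of_chirality {a : Cfg} (h : a.chirality = 0) : IsPolar a.dir :=
  parallel_of_chirality_eq_zero a.pt.2 h

theorem IsPolar.chirality {a : Cfg} (h : IsPolar a.dir) : a.chirality = 0 := by
  rw [chirality_eq, h.1, h.2]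
  ring

/-- The configuration with the given direction and nearest point of the second line. -/
def ofLine (v : S2) (x : E3) (hx : inner ℝ x (v : E3) = 0)
    (h : OrientedLine.mk v x (by simp) hx ∈ reducedTwoLineEmb) : Cfg := ⟨⟨_, h⟩⟩

/-- A segment of pairs `(u, x)`, with `u` normalized, bounds the distance of the limits of its end
points in terms of the directions alone. -/
theorem dist_shrink_zero_le {a b : Cfg} (hab : dist a.dir b.dir ≤ 1 / 2)
    (horth : ∀ t : I, inner ℝ (AffineMap.lineMap a.foot b.foot (t : ℝ) : E3)
      (AffineMap.lineMap (a.dir : E3) b.dir (t : ℝ)) = 0)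
    (hN : ∀ t : I, ∀ u x : E3, u = AffineMap.lineMap (a.dir : E3) b.dir (t : ℝ) →
      x = AffineMap.lineMap a.foot b.foot (t : ℝ) →
      u 1 * x 2 - u 2 * x 1 ≠ 0 ∨ (u 1 = 0 ∧ u 2 = 0) ∧ ¬ (x 1 = 0 ∧ x 2 = 0)) :
    dist (CompletedTwoLines.shrink 0 (a : CompletedTwoLines))
      (CompletedTwoLines.shrink 0 (b : CompletedTwoLines)) ≤ 4 * dist a.dir b.dir := by
  set u : I → E3 := fun t => AffineMap.lineMap (a.dir : E3) b.dir (t : ℝ) with hu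
  set x : I → E3 := fun t => AffineMap.lineMap a.foot b.foot (t : ℝ) with hx
  have hLx : LipschitzWith (nndist a.foot b.foot) x := by
    have := (lipschitzWith_lineMap (𝕜 := ℝ) a.foot b.foot).comp (LipschitzWith.subtype_val I)
    rwa [mul_one] at this
  have hLu : LipschitzWith (nndist a.dir b.dir) u := by
    have := (lipschitzWith_lineMap (𝕜 := ℝ) (a.dir : E3) b.dir).comp (LipschitzWith.subtype_val I)
    rwa [mul_one] at this
  have hnorm : ∀ t, 1 / 2 ≤ ‖u t‖ := by
    intro t
    have h1 : dist (u t) (u 0) ≤ 1 / 2 := by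
      refine (hLu.dist_le_mul t 0).trans ?_
      have h2 : dist t 0 ≤ 1 := by
        rw [Subtype.dist_eq, Real.dist_eq]
        simpa [abs_of_nonneg t.2.1] using t.2.2
      exact (mul_le_of_le_one_right (by positivity) h2).trans hab
    have h0 : u 0 = a.dir := by simp [hu]
    have h3 := norm_sub_norm_le (u 0) (u t)
    rw [← dist_eq_norm, dist_comm, h0, norm_dir] at h3
    rw [h0] at h1
    linarith
  have hne : ∀ t, u t ≠ 0 := fun t h => by
    have := hnorm t
    rw [h, norm_zero] at this
    linarith
  have hun : ∀ t, ‖‖u t‖⁻¹ • u t‖ = 1 := fun t => by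
    rw [norm_smul, norm_inv, norm_norm, inv_mul_cancel₀ (norm_ne_zero_iff.2 (hne t))]
  let c : I → OrientedLine := fun t => OrientedLine.mk (‖u t‖⁻¹ • u t) (x t) (hun t)
    (by rw [inner_smul_right, horth, mul_zero])
  have hcd : ∀ t, ((c t).direction : E3) = ‖u t‖⁻¹ • u t := fun _ => rfl
  have hcf : ∀ t, (c t).foot = x t := fun _ => rfl
  have hend : ∀ (t : I) (d : Cfg), u t = d.dir → x t = d.foot → c t = d.pt := by
    intro t d h1 h2
    refine OrientedLine.ext_iff'.2 ⟨Subtype.ext ?_, h2⟩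
    rw [hcd, h1, norm_dir, inv_one, one_smul]
    rfl
  have hK : LipschitzWith (4 * nndist a.dir b.dir) fun t => (c t).direction := by
    refine LipschitzWith.of_dist_le_mul fun s t => ?_
    rw [Subtype.dist_eq, hcd, hcd, dist_eq_norm]
    refine (norm_normalize_sub_normalize_le (hnorm s) (hne t)).trans ?_
    rw [NNReal.coe_mul, mul_assoc, ← dist_eq_norm]
    exact mul_le_mul_of_nonneg_left (hLu.dist_le_mul s t) (by norm_num)
  refine (CompletedTwoLines.dist_shrink_zero_le (c := c) (fun t => ?_)
    (hend 0 a (by simp [hu]) (by simp [hx])) (hend 1 b (by simp [hu]) (by simp [hx])) hK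
    (L := nndist a.foot b.foot) (by simpa only [hcf] using hLx)).trans (by simp)
  have hi : ‖u t‖⁻¹ ≠ 0 := inv_ne_zero (norm_ne_zero_iff.2 (hne t))
  rcases hN t (u t) (x t) rfl rfl with h | ⟨⟨h1, h2⟩, h⟩
  · refine mem_reduced_of_chirality_ne ?_
    have e : (c t).chirality = ‖u t‖⁻¹ * (u t 1 * x t 2 - u t 2 * x t 1) := by
      simp only [OrientedLine.chirality, hcd, hcf, PiLp.smul_apply, smul_eq_mul]
      ring
    rw [e]
    exact mul_ne_zero hi h
  · refine mem_reduced_of_parallel ?_ ?_ h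
    · simp [hcd, h1]
    · simp [hcd, h2]

theorem inner_foot_dir (a : Cfg) : inner ℝ a.foot (a.dir : E3) = 0 := (a.pt : OrientedLine).2.2

theorem lineMap_coord (x y : E3) (t : ℝ) (i : Fin 3) :
    (AffineMap.lineMap x y t : E3) i = x i + t * (y i - x i) := by
  simp [AffineMap.lineMap_apply]
  ring

theorem shrink_zero_eq_of_segment {a b : Cfg} (hd : a.dir = b.dir)
    (hN : ∀ t : I, ∀ x : E3, x = AffineMap.lineMap a.foot b.foot (t : ℝ) →
      (a.dir : E3) 1 * x 2 - (a.dir : E3) 2 * x 1 ≠ 0 ∨ IsPolar a.dir ∧ ¬ (x 1 = 0 ∧ x 2 = 0)) :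
    CompletedTwoLines.shrink 0 (a : CompletedTwoLines) = CompletedTwoLines.shrink 0 b := by
  have h0 : dist a.dir b.dir = 0 := by rw [hd, dist_self]
  refine dist_le_zero.1 ((dist_shrink_zero_le (by rw [h0]; norm_num) (fun t => ?_) ?_).trans
    (by rw [h0]; norm_num))
  · rw [← hd, AffineMap.lineMap_same_apply, AffineMap.lineMap_apply, vadd_eq_add, vsub_eq_sub,
      inner_add_left, inner_smul_left, inner_sub_left, inner_foot_dir, hd, inner_foot_dir]
    simp
  · rintro t u x rfl hx
    rw [← hd, AffineMap.lineMap_same_apply]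
    exact hN t x hx

theorem segment_ne {p q : ℝ} {t : I} (h : 0 < p * q) : p + t * (q - p) ≠ 0 := by
  intro h0
  have h1 : p * (p + t * (q - p)) = (1 - t) * p ^ 2 + t * (p * q) := by ring
  rw [h0, mul_zero] at h1
  have hp : 0 < p ^ 2 := by
    have : p ≠ 0 := by
      rintro rfl
      simp at h
    positivity
  have h2 := mul_nonneg (sub_nonneg.2 t.2.2) hp.le
  have h3 := mul_nonneg t.2.1 h.le
  have h4 : (t : ℝ) * (p * q) = 0 := by linarith
  have h5 : (t : ℝ) = 0 := (mul_eq_zero.1 h4).resolve_right h.ne'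
  rw [h5] at h1
  linarith

/-- The chirality is affine in the foot, so that it keeps its sign along the segment. -/
theorem shrink_zero_eq_of_chirality {a b : Cfg} (hd : a.dir = b.dir)
    (h : 0 < a.chirality * b.chirality) :
    CompletedTwoLines.shrink 0 (a : CompletedTwoLines) = CompletedTwoLines.shrink 0 b := by
  refine shrink_zero_eq_of_segment hd fun t x hx => .inl ?_
  subst hx
  rw [lineMap_coord, lineMap_coord]
  have := segment_ne (t := t) h
  rw [chirality_eq, chirality_eq, ← hd] at this
  convert this using 1
  ring

theorem foot_ne_of_isPolar {a : Cfg} (h : IsPolar a.dir) : ¬ (a.foot 1 = 0 ∧ a.foot 2 = 0) :=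
  foot_ne_of_parallel a.pt.2 h.1 h.2

/-- The segment between two feet that form no obtuse angle avoids the origin. -/
theorem shrink_zero_eq_of_isPolar_aux {a b : Cfg} (hd : a.dir = b.dir) (hp : IsPolar a.dir)
    (h : 0 ≤ a.foot 1 * b.foot 1 + a.foot 2 * b.foot 2) :
    CompletedTwoLines.shrink 0 (a : CompletedTwoLines) = CompletedTwoLines.shrink 0 b := by
  refine shrink_zero_eq_of_segment hd fun t x hx => .inr ⟨hp, ?_⟩
  subst hx
  rw [lineMap_coord, lineMap_coord]
  rintro ⟨h1, h2⟩
  have hb := foot_ne_of_isPolar (hd ▸ hp)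
  have ha := foot_ne_of_isPolar hp
  have e : (1 - t) * (a.foot 1 * b.foot 1 + a.foot 2 * b.foot 2) +
      t * (b.foot 1 ^ 2 + b.foot 2 ^ 2) = 0 := by
    linear_combination b.foot 1 * h1 + b.foot 2 * h2
  have hb' : 0 < b.foot 1 ^ 2 + b.foot 2 ^ 2 := by
    by_contra! hc
    exact hb ⟨by nlinarith [sq_nonneg (b.foot 1), sq_nonneg (b.foot 2)],
      by nlinarith [sq_nonneg (b.foot 1), sq_nonneg (b.foot 2)]⟩
  have e1 := mul_nonneg (sub_nonneg.2 t.2.2) h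
  have e2 := mul_nonneg t.2.1 hb'.le
  have e3 : (t : ℝ) * (b.foot 1 ^ 2 + b.foot 2 ^ 2) = 0 := by linarith
  have e4 : (t : ℝ) = 0 := (mul_eq_zero.1 e3).resolve_right hb'.ne'
  rw [e4] at h1 h2
  exact ha ⟨by linarith, by linarith⟩

theorem inner_E3 (x y : E3) : inner ℝ x y = x 0 * y 0 + x 1 * y 1 + x 2 * y 2 := by
  simp [PiLp.inner_apply, Fin.sum_univ_three]
  ring

/-- A punctured plane is connected, so that at a polar direction the limit does not depend on the
foot. -/
theorem shrink_zero_eq_of_isPolar {a b : Cfg} (hd : a.dir = b.dir) (hp : IsPolar a.dir) :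
    CompletedTwoLines.shrink 0 (a : CompletedTwoLines) = CompletedTwoLines.shrink 0 b := by
  -- a third point at a right angle to the first, on the side of the second
  obtain ⟨s, hs, hs0⟩ : ∃ s : ℝ, s ≠ 0 ∧
      0 ≤ s * (-a.foot 2 * b.foot 1 + a.foot 1 * b.foot 2) := by
    rcases le_total 0 (-a.foot 2 * b.foot 1 + a.foot 1 * b.foot 2) with h | h
    · exact ⟨1, one_ne_zero, by linarith⟩
    · exact ⟨-1, by norm_num, by linarith⟩
  let y : E3 := !₂[0, -(s * a.foot 2), s * a.foot 1]
  have hy1 : y 1 = -(s * a.foot 2) := rfl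
  have hy2 : y 2 = s * a.foot 1 := rfl
  let m : Cfg := ofLine a.dir y (by rw [inner_E3, hp.1, hp.2]; simp [y])
    (mem_reduced_of_parallel hp.1 hp.2 (by
      rintro ⟨h1, h2⟩
      change y 1 = 0 at h1
      change y 2 = 0 at h2
      rw [hy1, neg_eq_zero] at h1
      exact foot_ne_of_isPolar hp ⟨(mul_eq_zero.1 h2).resolve_left hs,
        (mul_eq_zero.1 h1).resolve_left hs⟩))
  have hmf : m.foot = y := rfl
  have hmd : m.dir = a.dir := rfl
  refine (shrink_zero_eq_of_isPolar_aux (b := m) hmd.symm hp ?_).trans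
    (shrink_zero_eq_of_isPolar_aux (hmd.trans hd) hp ?_)
  · rw [hmf, hy1, hy2]
    exact le_of_eq (by ring)
  · rw [hmf, hy1, hy2]
    linarith

/-- The limit depends only on the direction and on the side on which the line passes by the axis. -/
theorem shrink_zero_eq {a b : Cfg} (hd : a.dir = b.dir) {ε : ℝ} (ha : 0 ≤ ε * a.chirality)
    (hb : 0 ≤ ε * b.chirality) (hε : ε ≠ 0) :
    CompletedTwoLines.shrink 0 (a : CompletedTwoLines) = CompletedTwoLines.shrink 0 b := by
  by_cases hp : IsPolar a.dir
  · exact shrink_zero_eq_of_isPolar hd hp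
  · have ha0 : a.chirality ≠ 0 := fun h => hp (isPolar_of_chirality h)
    have hb0 : b.chirality ≠ 0 := fun h => hp (hd ▸ isPolar_of_chirality h)
    refine shrink_zero_eq_of_chirality hd ?_
    have h1 := lt_of_le_of_ne ha (mul_ne_zero hε ha0).symm
    have h2 := lt_of_le_of_ne hb (mul_ne_zero hε hb0).symm
    have h3 := mul_pos h1 h2
    have e : ε * a.chirality * (ε * b.chirality) = ε ^ 2 * (a.chirality * b.chirality) := by ring
    rw [e] at h3
    exact pos_of_mul_pos_right h3 (sq_nonneg ε)

end Cfg

namespace Cfg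

open OrientedLine Filter Topology

/-- The vector product of `e₁` with `u`, multiplied by `ε`. -/
def cross (ε : ℝ) (u : E3) : E3 := !₂[0, -(ε * u 2), ε * u 1]

theorem cross_zero (ε : ℝ) (u : E3) : cross ε u 0 = 0 := rfl

theorem cross_one (ε : ℝ) (u : E3) : cross ε u 1 = -(ε * u 2) := rfl

theorem cross_two (ε : ℝ) (u : E3) : cross ε u 2 = ε * u 1 := rfl

theorem inner_cross_self (ε : ℝ) (u : E3) : inner ℝ (cross ε u) u = 0 := by
  rw [inner_E3, cross_zero, cross_one, cross_two]
  ring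

theorem sq_add_sq_pos {p q : ℝ} (h : ¬ (p = 0 ∧ q = 0)) : 0 < p ^ 2 + q ^ 2 := by
  by_contra! hc
  exact h ⟨by nlinarith [sq_nonneg p, sq_nonneg q], by nlinarith [sq_nonneg p, sq_nonneg q]⟩

theorem exists_of_not_isPolar {ε : ℝ} (hε : ε ≠ 0) {v : S2} (hv : ¬ IsPolar v) :
    ∃ a : Cfg, a.dir = v ∧ a.foot = cross ε v := by
  refine ⟨ofLine v (cross ε v) (inner_cross_self ε v) (mem_reduced_of_chirality_ne ?_), rfl, rfl⟩
  change (v : E3) 1 * cross ε v 2 - (v : E3) 2 * cross ε v 1 ≠ 0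
  rw [cross_one, cross_two]
  convert mul_ne_zero hε (sq_add_sq_pos hv).ne' using 1
  ring

theorem exists_of_isPolar {v : S2} (hv : IsPolar v) {x : E3} (hx0 : x 0 = 0)
    (hx : ¬ (x 1 = 0 ∧ x 2 = 0)) : ∃ a : Cfg, a.dir = v ∧ a.foot = x :=
  ⟨ofLine v x (by rw [inner_E3, hv.1, hv.2, hx0]; simp) (mem_reduced_of_parallel hv.1 hv.2 hx),
    rfl, rfl⟩

theorem chirality_of_foot_eq_cross {ε : ℝ} {a : Cfg} (h : a.foot = cross ε a.dir) :
    a.chirality = ε * ((a.dir : E3) 1 ^ 2 + (a.dir : E3) 2 ^ 2) := by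
  rw [chirality_eq, h, cross_one, cross_two]
  ring

theorem exists_lift {ε : ℝ} (hε : ε ≠ 0) (v : S2) : ∃ a : Cfg, a.dir = v ∧ 0 ≤ ε * a.chirality := by
  by_cases hv : IsPolar v
  · obtain ⟨a, rfl, -⟩ := exists_of_isPolar hv (x := !₂[0, 1, 0]) rfl (by simp)
    exact ⟨a, rfl, by rw [IsPolar.chirality hv, mul_zero]⟩
  · obtain ⟨a, rfl, h⟩ := exists_of_not_isPolar hε hv
    refine ⟨a, rfl, ?_⟩
    rw [chirality_of_foot_eq_cross h, ← mul_assoc]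
    exact mul_nonneg (mul_self_nonneg ε) (by positivity)

/-- A configuration with a given direction that passes by the axis on the side given by the sign of
`ε`, or is parallel to it. -/
def lift (ε : ℝˣ) (v : S2) : Cfg := (exists_lift ε.ne_zero v).choose

theorem dir_lift (ε : ℝˣ) (v : S2) : (lift ε v).dir = v := (exists_lift ε.ne_zero v).choose_spec.1

theorem chirality_lift (ε : ℝˣ) (v : S2) : 0 ≤ ε * (lift ε v).chirality :=
  (exists_lift ε.ne_zero v).choose_spec.2

/-- The limit, when the line moves to the origin, of the configurations with direction `v` that pass
by the axis on the side given by the sign of `ε`. -/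
def limit (ε : ℝˣ) (v : S2) : CompletedTwoLines := CompletedTwoLines.shrink 0 (lift ε v : Cfg)

/-- The limit may be computed from any configuration with the given direction and side. -/
theorem limit_dir {ε : ℝˣ} {a : Cfg} (h : 0 ≤ ε * a.chirality) :
    limit ε a.dir = CompletedTwoLines.shrink 0 a :=
  shrink_zero_eq (dir_lift ε _) (chirality_lift ε _) h ε.ne_zero

/-- Away from the poles, the configurations with foot `ε e₁ × v` move along with the direction
`v`. -/
theorem dist_limit_le_of_segment {ε : ℝˣ} {v w : S2} (hd : dist v w ≤ 1 / 2)
    (hN : ∀ t : I, ¬ (AffineMap.lineMap (v : E3) w (t : ℝ) 1 = 0 ∧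
      AffineMap.lineMap (v : E3) w (t : ℝ) 2 = 0)) :
    dist (limit ε v) (limit ε w) ≤ 4 * dist v w := by
  have hv : ¬ IsPolar v := by simpa [IsPolar] using hN 0
  have hw : ¬ IsPolar w := by simpa [IsPolar] using hN 1
  obtain ⟨a, rfl, ha⟩ := exists_of_not_isPolar ε.ne_zero hv
  obtain ⟨b, rfl, hb⟩ := exists_of_not_isPolar ε.ne_zero hw
  have hpos : ∀ {d : Cfg}, d.foot = cross ε d.dir → 0 ≤ ε * d.chirality := fun {d} h => by
    rw [chirality_of_foot_eq_cross h, ← mul_assoc]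
    exact mul_nonneg (mul_self_nonneg _) (by positivity)
  rw [limit_dir (hpos ha), limit_dir (hpos hb)]
  have hfoot : ∀ t : ℝ, (AffineMap.lineMap a.foot b.foot t : E3) =
      cross ε (AffineMap.lineMap (a.dir : E3) b.dir t) := by
    intro t
    ext i
    rw [lineMap_coord, ha, hb]
    fin_cases i
    · simp [cross_zero]
    · simp only [Fin.mk_one, cross_one, lineMap_coord]
      ring
    · simp only [Fin.reduceFinMk, cross_two, lineMap_coord]
      ring
  refine dist_shrink_zero_le hd (fun t => ?_) ?_
  · rw [hfoot, inner_cross_self]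
  · rintro t u x hu rfl
    left
    rw [hfoot, ← hu, cross_one, cross_two]
    have h := hN t
    rw [← hu] at h
    convert mul_ne_zero ε.ne_zero (sq_add_sq_pos h).ne' using 1
    ring

/-- At a pole, the direction turns in the plane at a right angle to a fixed foot. -/
theorem dist_limit_le_of_isPolar {ε : ℝˣ} {v w : S2} (hd : dist v w ≤ 1 / 2) (hv : IsPolar v) :
    dist (limit ε v) (limit ε w) ≤ 4 * dist v w := by
  by_cases hw : IsPolar w
  · rw [hv.eq_of_dist_lt hw (by linarith), dist_self, dist_self, mul_zero]
  obtain ⟨b, rfl, hb⟩ := exists_of_not_isPolar ε.ne_zero hw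
  have hx : ¬ (cross ε b.dir 1 = 0 ∧ cross ε b.dir 2 = 0) := by
    rw [cross_one, cross_two]
    rintro ⟨h1, h2⟩
    rw [neg_eq_zero] at h1
    exact hw ⟨(mul_eq_zero.1 h2).resolve_left ε.ne_zero, (mul_eq_zero.1 h1).resolve_left ε.ne_zero⟩
  obtain ⟨a, rfl, ha⟩ := exists_of_isPolar hv (cross_zero ε b.dir) hx
  rw [limit_dir (by rw [IsPolar.chirality hv, mul_zero]), limit_dir (by
    rw [chirality_of_foot_eq_cross hb, ← mul_assoc]
    exact mul_nonneg (mul_self_nonneg _) (by positivity))]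
  -- the foot is constant along the segment, at a right angle to both directions
  refine dist_shrink_zero_le hd (fun t => ?_) ?_
  · rw [ha, hb, AffineMap.lineMap_same_apply, inner_E3, cross_zero, cross_one, cross_two,
      lineMap_coord, lineMap_coord, lineMap_coord, hv.1, hv.2]
    ring
  · rintro t u x hu rfl
    rw [ha, hb, AffineMap.lineMap_same_apply]
    have h1 : u 1 = t * (b.dir : E3) 1 := by rw [hu, lineMap_coord, hv.1]; ring
    have h2 : u 2 = t * (b.dir : E3) 2 := by rw [hu, lineMap_coord, hv.2]; ring
    by_cases ht : (t : ℝ) = 0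
    · right
      rw [h1, h2, ht, zero_mul, zero_mul]
      exact ⟨⟨rfl, rfl⟩, hx⟩
    · left
      rw [h1, h2, cross_one, cross_two]
      convert mul_ne_zero ht (mul_ne_zero ε.ne_zero (sq_add_sq_pos hw).ne') using 1
      ring

theorem add_mul_sub_ne_zero {p q : ℝ} (t : I) (h : |q - p| < |p|) : p + t * (q - p) ≠ 0 := by
  intro h0
  have h1 : |p| = t * |q - p| := by
    rw [eq_neg_of_add_eq_zero_left h0, abs_neg, abs_mul, abs_of_nonneg t.2.1]
    congr 2
    linarith
  have := mul_le_of_le_one_left (abs_nonneg (q - p)) t.2.2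
  linarith

theorem continuous_limit (ε : ℝˣ) : Continuous (limit ε) := by
  rw [continuous_iff_continuousAt]
  intro v
  have hd : Tendsto (fun w => dist v w) (𝓝 v) (𝓝 0) := by
    have : Continuous fun w => dist v w := by fun_prop
    simpa using this.tendsto v
  have hhalf : ∀ᶠ w in 𝓝 v, dist v w < 1 / 2 := hd.eventually_lt_const (by norm_num)
  suffices h : ∀ᶠ w in 𝓝 v, dist (limit ε v) (limit ε w) ≤ 4 * dist v w by
    rw [ContinuousAt, tendsto_iff_dist_tendsto_zero]
    refine squeeze_zero' (.of_forall fun _ => dist_nonneg) (g := fun w => 4 * dist v w) ?_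
      (by simpa using hd.const_mul 4)
    filter_upwards [h] with w hw
    rwa [dist_comm]
  by_cases hv : IsPolar v
  · filter_upwards [hhalf] with w hw
    exact dist_limit_le_of_isPolar hw.le hv
  · have hi : ∀ i : Fin 3, (v : E3) i ≠ 0 → ∀ᶠ w : S2 in 𝓝 v,
        |(w : E3) i - (v : E3) i| < |(v : E3) i| := by
      intro i hi
      have : Continuous fun w : S2 => |(w : E3) i - (v : E3) i| := by fun_prop
      refine (this.tendsto v).eventually_lt_const ?_
      simpa using hi
    rw [IsPolar, not_and_or] at hv
    rcases hv with hv | hv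
    · filter_upwards [hhalf, hi 1 hv] with w hw h
      refine dist_limit_le_of_segment hw.le fun t ht => ?_
      rw [lineMap_coord] at ht
      exact add_mul_sub_ne_zero t h ht.1
    · filter_upwards [hhalf, hi 2 hv] with w hw h
      refine dist_limit_le_of_segment hw.le fun t ht => ?_
      rw [lineMap_coord, lineMap_coord] at ht
      exact add_mul_sub_ne_zero t h ht.2

/-- The two sides meet at the poles. -/
theorem limit_isPolar (ε ε' : ℝˣ) {v : S2} (hv : IsPolar v) : limit ε v = limit ε' v :=
  shrink_zero_eq_of_isPolar ((dir_lift ε v).trans (dir_lift ε' v).symm) ((dir_lift ε v).symm ▸ hv)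

end Cfg

/-! ### The side on which a configuration passes by the axis -/

namespace PinchedTorus

theorem inl_eq_inr_of_isPolar {v : S2} (hv : IsPolar v) : inl v = inr v := by
  rcases isPolar_iff.1 hv with rfl | rfl
  · exact inr_north.symm
  · exact inr_south.symm

/-- The squared distance of a direction, as a point of the sphere, from the `x`-axis. -/
def width (v : S2) : ℝ := (v : E3) 1 ^ 2 + (v : E3) 2 ^ 2

theorem width_eq_zero_iff {v : S2} : width v = 0 ↔ IsPolar v := by
  constructor
  · intro h
    by_contra hv
    exact (Cfg.sq_add_sq_pos hv).ne' h
  · rintro ⟨h1, h2⟩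
    rw [width, h1, h2]
    ring

theorem width_nonneg (v : S2) : 0 ≤ width v := by
  unfold width
  positivity

theorem abs_width_sub_le (v w : S2) : |width v - width w| ≤ 2 * dist v w := by
  have hv := S2_sq v
  have hw := S2_sq w
  have e : width v - width w = ((w : E3) 0 + (v : E3) 0) * ((w : E3) 0 - (v : E3) 0) := by
    unfold width
    linear_combination hv - hw
  have h1 : |(w : E3) 0 - (v : E3) 0| ≤ dist v w := by
    rw [dist_comm, Subtype.dist_eq, dist_eq_norm]
    exact PiLp.norm_apply_le ((w : E3) - (v : E3)) 0
  have hb : ∀ u : S2, |(u : E3) 0| ≤ 1 := fun u => by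
    have := PiLp.norm_apply_le (u : E3) 0
    simpa using this
  have h2 : |(w : E3) 0 + (v : E3) 0| ≤ 2 := by
    have := abs_add_le ((w : E3) 0) ((v : E3) 0)
    linarith [hb v, hb w]
  rw [e, abs_mul]
  exact mul_le_mul h2 h1 (abs_nonneg _) two_pos.le

/-- The pinched torus as a subspace of `S² × ℝ`: the two graphs of `± width`. -/
def embed : C(PinchedTorus, S2 × ℝ) :=
  desc ⟨fun v => (v, width v), by unfold width; fun_prop⟩
    ⟨fun v => (v, -width v), by unfold width; fun_prop⟩
    (by simp [width_eq_zero_iff.2 (isPolar_iff.2 (.inl rfl))])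
    (by simp [width_eq_zero_iff.2 (isPolar_iff.2 (.inr rfl))])

theorem embed_inl (v : S2) : embed (inl v) = (v, width v) := rfl

theorem embed_inr (v : S2) : embed (inr v) = (v, -width v) := rfl

theorem fst_embed (x : PinchedTorus) : (embed x).1 = fold x := by
  revert x
  exact ind (fun _ => rfl) fun _ => rfl

theorem embed_injective : Function.Injective embed := by
  have key : ∀ v w, embed (inl v) = embed (inr w) → inl v = inr w := by
    intro v w h
    rw [embed_inl, embed_inr, Prod.mk.injEq] at h
    obtain ⟨rfl, h⟩ := h
    exact inl_eq_inr_of_isPolar (width_eq_zero_iff.1 (by linarith))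
  intro x y
  revert x y
  refine ind (fun v => ind (fun w h => ?_) (fun w h => key v w h))
    (fun v => ind (fun w h => (key w v h.symm).symm) (fun w h => ?_))
  · rw [show v = w from congrArg Prod.fst h]
  · rw [show v = w from congrArg Prod.fst h]

theorem isClosedEmbedding_embed : Topology.IsClosedEmbedding embed :=
  embed.continuous.isClosedEmbedding embed_injective

theorem eq_north_iff {x : PinchedTorus} : x = north ↔ fold x = northPole := by
  refine ⟨fun h => h ▸ rfl, ?_⟩
  refine ind (p := fun x => fold x = northPole → x = north) (fun v h => ?_) (fun v h => ?_) x
  · rw [show v = northPole from h, inl_north]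
  · rw [show v = northPole from h, inr_north]

theorem eq_south_iff {x : PinchedTorus} : x = south ↔ fold x = southPole := by
  refine ⟨fun h => h ▸ rfl, ?_⟩
  refine ind (p := fun x => fold x = southPole → x = south) (fun v h => ?_) (fun v h => ?_) x
  · rw [show v = southPole from h, inl_south]
  · rw [show v = southPole from h, inr_south]

end PinchedTorus

namespace Cfg

open PinchedTorus OrientedLine

/-- The direction of the second line, on the first sphere if the chirality is positive and on the
second one otherwise. At chirality `0` the direction is a pole, so that the choice does not
matter. -/
def side (a : Cfg) : PinchedTorus := if 0 < a.chirality then inl a.dir else inr a.dir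

theorem side_of_nonneg {a : Cfg} (h : 0 ≤ a.chirality) : a.side = inl a.dir := by
  rcases h.eq_or_lt with h | h
  · rw [side, if_neg h.not_lt, inl_eq_inr_of_isPolar (isPolar_of_chirality h.symm)]
  · rw [side, if_pos h]

theorem side_of_nonpos {a : Cfg} (h : a.chirality ≤ 0) : a.side = inr a.dir := by
  rw [side, if_neg h.not_gt]

theorem fold_side (a : Cfg) : fold a.side = a.dir := by
  unfold side
  split_ifs <;> rfl

theorem side_scale (r : Set.Ioc (0 : ℝ) 1) (a : Cfg) : (scale r a).side = a.side := by
  have h : (scale r a).chirality = r * a.chirality := chirality_scale _ _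
  have hd : (scale r a).dir = a.dir := rfl
  simp only [side, h, hd, mul_pos_iff_of_pos_left r.2.1]

theorem abs_snd_embed_side (a : Cfg) : |(embed a.side).2| = width a.dir := by
  unfold side
  split_ifs
  · rw [embed_inl, abs_of_nonneg (width_nonneg _)]
  · rw [embed_inr, abs_neg, abs_of_nonneg (width_nonneg _)]

/-- A short path either keeps the sign of the chirality or passes through a parallel to the axis,
near which `width` is small. -/
theorem uniformContinuous_embed_side : UniformContinuous fun a : Cfg => embed a.side := by
  refine Metric.uniformContinuous_iff.2 fun ε hε => ⟨min (ε / 4) 1, by positivity,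
    fun {a b} hab => ?_⟩
  obtain ⟨γ, hγ⟩ := PathSpace.exists_path_of_dist_lt (min_le_right _ _) hab
  have hγ' : ∀ s t, dist (γ s : OrientedLine).direction (γ t : OrientedLine).direction < ε / 4 :=
    fun s t => (dist_direction_le _ _).trans_lt ((hγ s t).trans_le (min_le_left _ _))
  have hdir : dist a.dir b.dir < ε / 4 := by
    have := hγ' 0 1
    rwa [γ.source, γ.target] at this
  rw [Prod.dist_eq, max_lt_iff, fst_embed, fst_embed, fold_side, fold_side, Real.dist_eq]
  refine ⟨by linarith, ?_⟩
  by_cases h : ∃ t, (γ t : OrientedLine).chirality = 0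
  · -- the path passes through a parallel line, where the two sides meet
    obtain ⟨t, ht⟩ := h
    have h0 : width (γ t : OrientedLine).direction = 0 :=
      width_eq_zero_iff.2 (parallel_of_chirality_eq_zero (γ t).2 ht)
    have h1 := abs_width_sub_le a.dir (γ t : OrientedLine).direction
    have h2 := abs_width_sub_le b.dir (γ t : OrientedLine).direction
    rw [h0, sub_zero, abs_of_nonneg (width_nonneg _)] at h1 h2
    have h3 := hγ' 0 t
    have h4 := hγ' 1 t
    rw [γ.source] at h3
    rw [γ.target] at h4
    have h5 := abs_sub (embed a.side).2 (embed b.side).2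
    rw [abs_snd_embed_side, abs_snd_embed_side] at h5
    change dist a.dir _ < _ at h3
    change dist b.dir _ < _ at h4
    linarith
  · have hw := abs_width_sub_le a.dir b.dir
    have hc : Continuous fun t => (γ t : OrientedLine).chirality :=
      continuous_chirality.comp (continuous_subtype_val.comp γ.continuous)
    have hsign : 0 < a.chirality ↔ 0 < b.chirality := by
      have ha : (γ 0 : OrientedLine).chirality = a.chirality := by rw [γ.source]; rfl
      have hb : (γ 1 : OrientedLine).chirality = b.chirality := by rw [γ.target]; rfl
      constructor <;> intro h1 <;> by_contra! h2
      · exact h (mem_range_of_exists_le_of_exists_ge hc ⟨1, hb.trans_le h2⟩ ⟨0, ha ▸ h1.le⟩)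
      · exact h (mem_range_of_exists_le_of_exists_ge hc ⟨0, ha.trans_le h2⟩ ⟨1, hb ▸ h1.le⟩)
    unfold side
    by_cases h1 : 0 < a.chirality
    · rw [if_pos h1, if_pos (hsign.1 h1), embed_inl, embed_inl]
      linarith
    · rw [if_neg h1, if_neg (mt hsign.2 h1), embed_inr, embed_inr, ← abs_neg]
      have e : -(-width a.dir - -width b.dir) = width a.dir - width b.dir := by ring
      rw [e]
      linarith

end Cfg

/-! ### The homotopy equivalence with the pinched torus -/

namespace CompletedTwoLines

open UniformSpace PinchedTorus

/-- The extension of `Cfg.side` to the completion, in `S² × ℝ`. -/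
def embeddedSide : CompletedTwoLines → S2 × ℝ := Completion.extension fun a : Cfg => embed a.side

theorem embeddedSide_coe (a : Cfg) : embeddedSide (a : CompletedTwoLines) = embed a.side :=
  Completion.extension_coe Cfg.uniformContinuous_embed_side a

theorem embeddedSide_mem_range (c : CompletedTwoLines) : embeddedSide c ∈ Set.range embed := by
  refine Completion.induction_on c ?_ fun a => ?_
  · exact isClosedEmbedding_embed.isClosed_range.preimage Completion.continuous_extension
  · rw [embeddedSide_coe]
    exact ⟨_, rfl⟩

/-- The direction of the second line together with the side on which the line passes by the axis, as
a map from the completion to the pinched torus. -/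
def side : C(CompletedTwoLines, PinchedTorus) where
  toFun c := isClosedEmbedding_embed.isEmbedding.toHomeomorph.symm
    ⟨embeddedSide c, embeddedSide_mem_range c⟩
  continuous_toFun := (Homeomorph.continuous _).comp
    (Completion.continuous_extension.subtype_mk _)

theorem embed_side (c : CompletedTwoLines) : embed (side c) = embeddedSide c :=
  congrArg Subtype.val (isClosedEmbedding_embed.isEmbedding.toHomeomorph.apply_symm_apply
    ⟨embeddedSide c, embeddedSide_mem_range c⟩)

theorem side_coe (a : Cfg) : side (a : CompletedTwoLines) = a.side :=
  embed_injective ((embed_side _).trans (embeddedSide_coe a))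

theorem fold_side (c : CompletedTwoLines) : fold (side c) = (secondLine c).direction := by
  refine Completion.induction_on c (isClosed_eq (by fun_prop) ?_) fun a => ?_
  · exact OrientedLine.continuous_direction.comp secondLine.continuous
  · rw [side_coe, Cfg.fold_side, secondLine_coe]
    rfl

instance : T2Space PinchedTorus := isClosedEmbedding_embed.isEmbedding.t2Space

theorem side_scale (r : Set.Ioc (0 : ℝ) 1) (c : CompletedTwoLines) : side (scale r c) = side c := by
  refine Completion.induction_on c (isClosed_eq ?_ (by fun_prop)) fun a => ?_
  · exact side.continuous.comp (lipschitzWith_scale r).continuous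
  · rw [scale_coe, side_coe, side_coe, Cfg.side_scale]

theorem side_shrink (t : I) (c : CompletedTwoLines) : side (shrink t c) = side c := by
  have h := (side.continuous.tendsto (shrink t c)).comp (tendsto_shrink t c)
  have hconst : (side ∘ fun n => scale (approx t n) c) = fun _ => side c :=
    funext fun n => side_scale _ c
  rw [hconst] at h
  exact tendsto_nhds_unique h tendsto_const_nhds

/-- The section of `side`: the limits of configurations as the second line moves to the origin. -/
def ofSide : C(PinchedTorus, CompletedTwoLines) :=
  desc ⟨Cfg.limit 1, Cfg.continuous_limit 1⟩ ⟨Cfg.limit (-1), Cfg.continuous_limit (-1)⟩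
    (Cfg.limit_isPolar _ _ (isPolar_iff.2 (.inl rfl)))
    (Cfg.limit_isPolar _ _ (isPolar_iff.2 (.inr rfl)))

theorem ofSide_side (c : CompletedTwoLines) : ofSide (side c) = shrink 0 c := by
  refine Completion.induction_on c (isClosed_eq (by fun_prop)
    (lipschitzWith_shrink 0).continuous) fun a : Cfg => ?_
  · rw [side_coe]
    rcases le_total 0 a.chirality with h | h
    · rw [Cfg.side_of_nonneg h]
      exact Cfg.limit_dir (by simpa using h)
    · rw [Cfg.side_of_nonpos h]
      exact Cfg.limit_dir (by simpa using h)

theorem side_ofSide (x : PinchedTorus) : side (ofSide x) = x := by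
  revert x
  refine ind (fun v => ?_) (fun v => ?_)
  · have h := Cfg.chirality_lift 1 v
    change side (shrink 0 (Cfg.lift 1 v : Cfg)) = _
    rw [side_shrink, side_coe, Cfg.side_of_nonneg (by simpa using h), Cfg.dir_lift]
  · have h := Cfg.chirality_lift (-1) v
    change side (shrink 0 (Cfg.lift (-1) v : Cfg)) = _
    rw [side_shrink, side_coe, Cfg.side_of_nonpos (by simpa using h), Cfg.dir_lift]

/-- The completed configuration space is homotopy equivalent to the pinched torus, by the map
`side`, which forgets the foot. -/
def equivPinchedTorus : CompletedTwoLines ≃ₕ PinchedTorus where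
  toFun := side
  invFun := ofSide
  left_inv := ⟨⟨⟨fun p => shrink p.1 p.2, continuous_shrink⟩, fun c => (ofSide_side c).symm,
    shrink_one⟩⟩
  right_inv := by
    rw [show side.comp ofSide = ContinuousMap.id _ from ContinuousMap.ext side_ofSide]

theorem secondLine_ofSide (x : PinchedTorus) :
    secondLine (ofSide x) = OrientedLine.throughOrigin (fold x) := by
  have h : ofSide x = shrink 0 (ofSide x) := by rw [← ofSide_side, side_ofSide]
  rw [h, secondLine_shrink, Set.Icc.coe_zero, OrientedLine.scale_zero, ← fold_side, side_ofSide]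

end CompletedTwoLines

/-! ### The space of oriented lines -/

namespace OrientedLine

/-- The direction of an oriented line, as a continuous map. -/
def directionMap : C(OrientedLine, S2) := ⟨direction, continuous_direction⟩

theorem throughOrigin_comp_directionMap :
    (throughOrigin.comp directionMap).Homotopic (ContinuousMap.id OrientedLine) :=
  ⟨⟨⟨fun p => scale p.1 p.2,
    continuous_scale.comp ((continuous_subtype_val.comp continuous_fst).prodMk continuous_snd)⟩,
    fun l => scale_zero l, fun l => scale_one l⟩⟩

/-- The space of oriented lines deformation retracts onto the sphere of directions. -/
def sphereEquiv : S2 ≃ₕ OrientedLine where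
  toFun := throughOrigin
  invFun := directionMap
  left_inv := ContinuousMap.Homotopic.refl _
  right_inv := throughOrigin_comp_directionMap

end OrientedLine

end

theorem mainTheorem2 :
    (∃ h : S2 ≃ₕ OrientedLine, h.toFun = OrientedLine.throughOrigin) ∧
    ∃ (e : CompletedTwoLines ≃ₕ PinchedTorus) (g : PinchedTorus ≃ₕ WedgeS2S2S1),
      secondLine.Homotopic
        (OrientedLine.throughOrigin.comp (PinchedTorus.fold.comp e.toFun)) ∧
      PinchedTorus.fold.Homotopic (WedgeS2S2S1.fold.comp g.toFun) ∧
      (∀ c : CompletedTwoLines,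
        e c = PinchedTorus.north ↔ (secondLine c).direction = northPole) ∧
      (∀ c : CompletedTwoLines,
        e c = PinchedTorus.south ↔ (secondLine c).direction = southPole) ∧
      secondLine (e.symm PinchedTorus.north) = OrientedLine.throughOrigin northPole ∧
      secondLine (e.symm PinchedTorus.south) = OrientedLine.throughOrigin southPole := by
  refine ⟨⟨OrientedLine.sphereEquiv, rfl⟩, CompletedTwoLines.equivPinchedTorus, pinchedEquivWedge,
    ?_, fold_homotopic_fold_comp, fun c => ?_, fun c => ?_, ?_, ?_⟩
  · have h : PinchedTorus.fold.comp CompletedTwoLines.side =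
        OrientedLine.directionMap.comp secondLine := ContinuousMap.ext CompletedTwoLines.fold_side
    change secondLine.Homotopic (OrientedLine.throughOrigin.comp
      (PinchedTorus.fold.comp CompletedTwoLines.side))
    rw [h]
    exact (OrientedLine.throughOrigin_comp_directionMap.comp
      (ContinuousMap.Homotopic.refl secondLine)).symm
  · rw [← CompletedTwoLines.fold_side]
    exact PinchedTorus.eq_north_iff
  · rw [← CompletedTwoLines.fold_side]
    exact PinchedTorus.eq_south_iff
  · exact CompletedTwoLines.secondLine_ofSide PinchedTorus.north
  · exact CompletedTwoLines.secondLine_ofSide PinchedTorus.south
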